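/- Let $A$ be a non-zero abelian C$^*$-algebra, let $A\overline\otimes A$ be its C$^*$-tensor product with itself (the completion of the algebraic tensor product $A\otimes A$ in its unique C$^*$-norm), and let $M(\cdot)$ denote the multiplier algebra. Let $\Delta : A\to M(A\overline\otimes A)$ be a comultiplication on $A$, that is, a $^*$-homomorphism such that * $\Delta$ is non-degenerate: the linear span of $\Delta(A)(A\otimes A)$ is dense in $A\overline\otimes A$; * $\Delta$ is coassociative: $(\Delta\otimes\iota)\Delta=(\iota\otimes\Delta)\Delta$, where $\iota$ is the identity map of $A$, and $\Delta\otimes\iota$ and $\iota\otimes\Delta$ denote the unique extensions to $^*$-homomorphisms $M(A\overline\otimes A)\to M(A\overline\otimes A\overline\otimes A)$. Write $\Delta(A)(1\otimes A)$ and $\Delta(A)(A\otimes 1)$ for the linear spans in $M(A\overline\otimes A)$ of the elements $\Delta(a)(1\otimes b)$, respectively $\Delta(a)(b\otimes 1)$, with $a,b\in A$. Assume that $\Delta(A)(1\otimes A)$ and $\Delta(A)(A\otimes 1)$ are contained in $A\overline\otimes A$ and dense in it. Assume also that, for $a,b\in A$, $\Delta(a)(1\otimes b)=0$ implies $a=0$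 or $b=0$. Then there are a locally compact (Hausdorff) topological group $G$ and a $^*$-isomorphism $A\cong C_0(G)$ under which $\Delta$ is given by the multiplication of $G$: with $A\overline\otimes A$ identified with $C_0(G\times G)$ by $(a\otimes b)(s,t)=a(s)b(t)$, and $M(A\overline\otimes A)$ with the bounded continuous functions on $G\times G$ acting by multiplication, one has $(\Delta(a))(s,t)=a(st)$ for all $a\in A$ and $s,t\in G$. -/

import Mathlib

open scoped TensorProduct MultiplierAlgebra ZeroAtInfty

universe u v w

noncomputable section

/-! ### C⋆-seminorms on the algebraic tensor product and the C⋆-tensor product -/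

/-- A C⋆-seminorm on the algebraic tensor product of two C⋆-algebras. (The bound on elementary tensors
is automatic for C⋆-seminorms; it is recorded so that the supremum of all of them is visibly
finite.) -/
structure CStarSeminorm (A : Type u) (B : Type v) [NonUnitalCStarAlgebra A]
    [NonUnitalCStarAlgebra B] extends Seminorm ℂ (A ⊗[ℂ] B) where
  mul_le' : ∀ x y : A ⊗[ℂ] B, toSeminorm (x * y) ≤ toSeminorm x * toSeminorm y
  star_mul_self' : ∀ x : A ⊗[ℂ] B, toSeminorm (star x * x) = toSeminorm x * toSeminorm x
  tmul_le' : ∀ (a : A) (b : B), toSeminorm (a ⊗ₜ[ℂ] b) ≤ ‖a‖ * ‖b‖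

namespace CStarSeminorm

variable {A : Type u} {B : Type v} [NonUnitalCStarAlgebra A] [NonUnitalCStarAlgebra B]

instance : Nonempty (CStarSeminorm A B) :=
  ⟨{ toSeminorm := 0
     mul_le' := fun _ _ => by simp
     star_mul_self' := fun _ => by simp
     tmul_le' := fun a b => by simpa using mul_nonneg (norm_nonneg a) (norm_nonneg b) }⟩

theorem bddAbove (x : A ⊗[ℂ] B) :
    BddAbove (Set.range fun p : CStarSeminorm A B => p.toSeminorm x) := by
  induction x with
  | zero => exact ⟨0, by rintro _ ⟨p, rfl⟩; simp⟩
  | tmul a b => exact ⟨‖a‖ * ‖b‖, by rintro _ ⟨p, rfl⟩; exact p.tmul_le' a b⟩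
  | add x y hx hy =>
    obtain ⟨C, hC⟩ := hx
    obtain ⟨D, hD⟩ := hy
    refine ⟨C + D, ?_⟩
    rintro _ ⟨p, rfl⟩
    exact (map_add_le_add p.toSeminorm x y).trans (add_le_add (hC ⟨p, rfl⟩) (hD ⟨p, rfl⟩))

/-- The largest C⋆-seminorm on the algebraic tensor product. -/
def maxNorm (x : A ⊗[ℂ] B) : ℝ := ⨆ p : CStarSeminorm A B, p.toSeminorm x

theorem le_maxNorm (p : CStarSeminorm A B) (x : A ⊗[ℂ] B) : p.toSeminorm x ≤ maxNorm x :=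
  le_ciSup (bddAbove x) p

theorem maxNorm_le {x : A ⊗[ℂ] B} {C : ℝ} (h : ∀ p : CStarSeminorm A B, p.toSeminorm x ≤ C) :
    maxNorm x ≤ C :=
  ciSup_le h

theorem maxNorm_add_le (x y : A ⊗[ℂ] B) : maxNorm (x + y) ≤ maxNorm x + maxNorm y :=
  maxNorm_le fun p => (map_add_le_add p.toSeminorm x y).trans
    (add_le_add (le_maxNorm p x) (le_maxNorm p y))

theorem maxNorm_smul (c : ℂ) (x : A ⊗[ℂ] B) : maxNorm (c • x) = ‖c‖ * maxNorm x := by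
  simp only [maxNorm, map_smul_eq_mul]
  exact (Real.mul_iSup_of_nonneg (norm_nonneg c) _).symm

theorem maxNorm_nonneg (x : A ⊗[ℂ] B) : 0 ≤ maxNorm x :=
  (apply_nonneg (Classical.arbitrary (CStarSeminorm A B)).toSeminorm x).trans (le_maxNorm _ x)

theorem maxNorm_mul_le (x y : A ⊗[ℂ] B) : maxNorm (x * y) ≤ maxNorm x * maxNorm y :=
  maxNorm_le fun p => (p.mul_le' x y).trans <|
    mul_le_mul (le_maxNorm p x) (le_maxNorm p y) (apply_nonneg p.toSeminorm y) (maxNorm_nonneg x)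

theorem maxNorm_mul_self_le (x : A ⊗[ℂ] B) : maxNorm x * maxNorm x ≤ maxNorm (star x * x) := by
  have h : maxNorm x ≤ √(maxNorm (star x * x)) := maxNorm_le fun p => by
    refine Real.le_sqrt_of_sq_le ?_
    rw [sq]
    exact (p.star_mul_self' x).symm.le.trans (le_maxNorm p _)
  calc maxNorm x * maxNorm x ≤ √(maxNorm (star x * x)) * √(maxNorm (star x * x)) :=
        mul_self_le_mul_self (maxNorm_nonneg x) h
    _ = maxNorm (star x * x) := Real.mul_self_sqrt (maxNorm_nonneg _)

end CStarSeminorm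

open CStarSeminorm

section PreTensor

variable (A : Type u) (B : Type v) [NonUnitalCStarAlgebra A] [NonUnitalCStarAlgebra B]

/-- The algebraic tensor product, to be equipped with the largest C⋆-seminorm. -/
def PreCStarTensor : Type max u v := A ⊗[ℂ] B

namespace PreCStarTensor

instance : NonUnitalRing (PreCStarTensor A B) := inferInstanceAs (NonUnitalRing (A ⊗[ℂ] B))
instance : StarRing (PreCStarTensor A B) := inferInstanceAs (StarRing (A ⊗[ℂ] B))
instance : Module ℂ (PreCStarTensor A B) := inferInstanceAs (Module ℂ (A ⊗[ℂ] B))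
instance : StarModule ℂ (PreCStarTensor A B) := inferInstanceAs (StarModule ℂ (A ⊗[ℂ] B))
instance : IsScalarTower ℂ (PreCStarTensor A B) (PreCStarTensor A B) :=
  inferInstanceAs (IsScalarTower ℂ (A ⊗[ℂ] B) (A ⊗[ℂ] B))
instance : SMulCommClass ℂ (PreCStarTensor A B) (PreCStarTensor A B) :=
  inferInstanceAs (SMulCommClass ℂ (A ⊗[ℂ] B) (A ⊗[ℂ] B))

/-- The largest C⋆-seminorm, as a seminorm. -/
def maxSeminorm : Seminorm ℂ (PreCStarTensor A B) :=
  Seminorm.of (fun x => maxNorm (A := A) (B := B) x)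
    (fun x y => maxNorm_add_le x y) (fun c x => maxNorm_smul c x)

instance : SeminormedAddCommGroup (PreCStarTensor A B) :=
  (maxSeminorm A B).toAddGroupSeminorm.toSeminormedAddCommGroup

instance : NonUnitalSeminormedRing (PreCStarTensor A B) where
  __ := (inferInstance : SeminormedAddCommGroup (PreCStarTensor A B))
  __ := (inferInstance : NonUnitalRing (PreCStarTensor A B))
  norm_mul_le x y := maxNorm_mul_le (A := A) (B := B) x y

instance : NormedSpace ℂ (PreCStarTensor A B) where
  norm_smul_le c x := (map_smul_eq_mul (maxSeminorm A B) c x).le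

theorem norm_def (x : PreCStarTensor A B) : ‖x‖ = maxNorm (A := A) (B := B) x := rfl

theorem norm_mul_self_le (x : PreCStarTensor A B) : ‖x‖ * ‖x‖ ≤ ‖star x * x‖ :=
  maxNorm_mul_self_le (A := A) (B := B) x

instance : NormedStarGroup (PreCStarTensor A B) where
  norm_star_le x := by
    have key : ∀ y : PreCStarTensor A B, ‖y‖ ≤ ‖star y‖ := fun y => by
      by_contra! h
      have h1 := (norm_mul_self_le A B y).trans (norm_mul_le _ _)
      have h2 : 0 < ‖y‖ := (norm_nonneg _).trans_lt h
      exact absurd h1 (not_le.2 (mul_lt_mul_of_pos_right h h2))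
    simpa using key (star x)

end PreCStarTensor

/-- The C⋆-tensor product of two C⋆-algebras: the completion of the algebraic tensor product in its
largest C⋆-norm (the only C⋆-norm there is when one of the factors is abelian). -/
def CStarTensor : Type max u v := UniformSpace.Completion (PreCStarTensor A B)

end PreTensor

infixl:70 " ⊗⋆ " => CStarTensor

namespace CStarTensor

open UniformSpace

section Instances

variable (A : Type u) (B : Type v) [NonUnitalCStarAlgebra A] [NonUnitalCStarAlgebra B]

instance : NormedAddCommGroup (A ⊗⋆ B) :=
  inferInstanceAs (NormedAddCommGroup (Completion (PreCStarTensor A B)))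
/-- Scalar multiplication on the completion. -/
@[irreducible] def smulFun (c : ℂ) (x : A ⊗⋆ B) : A ⊗⋆ B :=
  (c • (show Completion (PreCStarTensor A B) from x) : Completion (PreCStarTensor A B))

instance : SMul ℂ (A ⊗⋆ B) := ⟨smulFun A B⟩

theorem smul_eq (c : ℂ) (x : A ⊗⋆ B) :
    c • x = (c • (show Completion (PreCStarTensor A B) from x) :
      Completion (PreCStarTensor A B)) := by
  change smulFun A B c x = _
  unfold smulFun
  rfl

instance : NormedSpace ℂ (A ⊗⋆ B) where
  one_smul x := (smul_eq A B 1 x).trans (one_smul ℂ (show Completion (PreCStarTensor A B) from x))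
  mul_smul c d x := by
    rw [smul_eq, smul_eq, smul_eq]
    exact mul_smul c d (show Completion (PreCStarTensor A B) from x)
  smul_zero c := by
    rw [smul_eq]
    exact smul_zero (A := Completion (PreCStarTensor A B)) c
  smul_add c x y := by
    rw [smul_eq, smul_eq, smul_eq]
    exact smul_add c (show Completion (PreCStarTensor A B) from x)
      (show Completion (PreCStarTensor A B) from y)
  add_smul c d x := by
    rw [smul_eq, smul_eq, smul_eq]
    exact add_smul c d (show Completion (PreCStarTensor A B) from x)
  zero_smul x := (smul_eq A B 0 x).trans
    (zero_smul ℂ (show Completion (PreCStarTensor A B) from x))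
  norm_smul_le c x := by
    rw [smul_eq]
    exact norm_smul_le c (show Completion (PreCStarTensor A B) from x)

instance : CompleteSpace (A ⊗⋆ B) :=
  inferInstanceAs (CompleteSpace (Completion (PreCStarTensor A B)))

/-- The canonical isometric map of the algebraic tensor product into its completion. -/
def ofPre : PreCStarTensor A B →ₗᵢ[ℂ] A ⊗⋆ B where
  toFun x := (x : Completion (PreCStarTensor A B))
  map_add' x y := Completion.coe_add x y
  map_smul' c x := (Completion.coe_smul c x).trans (smul_eq A B c _).symm
  norm_map' x := Completion.norm_coe x

theorem denseRange_ofPre : DenseRange (ofPre A B) :=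
  Completion.denseRange_coe (α := PreCStarTensor A B)

/-- Multiplication on the completion: the continuous extension of the multiplication of the
algebraic tensor product. -/
@[irreducible] def mulFun : A ⊗⋆ B → A ⊗⋆ B → A ⊗⋆ B :=
  Function.curry <|
    ((Completion.isDenseInducing_coe (α := PreCStarTensor A B)).prodMap
      (Completion.isDenseInducing_coe (α := PreCStarTensor A B))).extend
      (fun p : PreCStarTensor A B × PreCStarTensor A B => ofPre A B (p.1 * p.2))

/-- Involution on the completion: the continuous extension of the involution of the
algebraic tensor product. -/
@[irreducible] def starFun : A ⊗⋆ B → A ⊗⋆ B :=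
  (Completion.isDenseInducing_coe (α := PreCStarTensor A B)).extend
    (fun p : PreCStarTensor A B => ofPre A B (star p))

instance : Mul (A ⊗⋆ B) := ⟨mulFun A B⟩

instance : Star (A ⊗⋆ B) := ⟨starFun A B⟩

theorem ofPre_mul (x y : PreCStarTensor A B) : ofPre A B (x * y) = ofPre A B x * ofPre A B y := by
  change _ = mulFun A B _ _
  unfold mulFun
  exact ((Completion.isDenseInducing_coe.prodMap Completion.isDenseInducing_coe).extend_eq
    (f := fun p : PreCStarTensor A B × PreCStarTensor A B => ofPre A B (p.1 * p.2))
    ((ofPre A B).continuous.comp continuous_mul) (x, y)).symm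

theorem ofPre_star (x : PreCStarTensor A B) : ofPre A B (star x) = star (ofPre A B x) := by
  change _ = starFun A B _
  unfold starFun
  exact (Completion.isDenseInducing_coe.extend_eq
    (f := fun p : PreCStarTensor A B => ofPre A B (star p))
    ((ofPre A B).continuous.comp continuous_star) x).symm

instance : ContinuousMul (A ⊗⋆ B) where
  continuous_mul := by
    let m : PreCStarTensor A B →+ PreCStarTensor A B →+ A ⊗⋆ B :=
      (AddMonoidHom.mul : PreCStarTensor A B →+ PreCStarTensor A B →+ PreCStarTensor A B).compr₂
        (ofPre A B).toLinearMap.toAddMonoidHom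
    have hm : Continuous fun p : PreCStarTensor A B × PreCStarTensor A B => m p.1 p.2 :=
      (ofPre A B).continuous.comp continuous_mul
    have di : IsDenseInducing (Completion.toCompl : PreCStarTensor A B →+ _) :=
      Completion.isDenseInducing_coe
    change Continuous fun p : A ⊗⋆ B × A ⊗⋆ B => mulFun A B p.1 p.2
    unfold mulFun
    exact (di.extend_Z_bilin di hm :)

instance : ContinuousStar (A ⊗⋆ B) where
  continuous_star := by
    have hu : UniformContinuous fun p : PreCStarTensor A B => ofPre A B (star p) :=
      (ofPre A B).isometry.uniformContinuous.comp
        (AddMonoidHomClass.isometry_of_norm (starAddEquiv (R := PreCStarTensor A B))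
          norm_star).uniformContinuous
    change Continuous (starFun A B)
    unfold starFun
    exact (uniformContinuous_uniformly_extend (Completion.isUniformInducing_coe _)
      Completion.denseRange_coe hu).continuous

variable {A B} in
@[elab_as_elim]
theorem induction₁ {p : A ⊗⋆ B → Prop} (a : A ⊗⋆ B) (hp : IsClosed {a | p a})
    (ih : ∀ x, p (ofPre A B x)) : p a :=
  Completion.induction_on a hp ih

variable {A B} in
protected theorem mul_assoc (a b c : A ⊗⋆ B) : a * b * c = a * (b * c) := by
  induction a using induction₁
  case hp => exact isClosed_eq (by fun_prop) (by fun_prop)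
  rename_i a
  induction b using induction₁
  case hp => exact isClosed_eq (by fun_prop) (by fun_prop)
  rename_i b
  induction c using induction₁
  case hp => exact isClosed_eq (by fun_prop) (by fun_prop)
  simp only [← ofPre_mul, mul_assoc]

variable {A B} in
protected theorem mul_add (a b c : A ⊗⋆ B) : a * (b + c) = a * b + a * c := by
  induction a using induction₁
  case hp => exact isClosed_eq (by fun_prop) (by fun_prop)
  rename_i a
  induction b using induction₁
  case hp => exact isClosed_eq (by fun_prop) (by fun_prop)
  rename_i b
  induction c using induction₁
  case hp => exact isClosed_eq (by fun_prop) (by fun_prop)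
  simp only [← ofPre_mul, ← map_add, mul_add]

variable {A B} in
protected theorem add_mul (a b c : A ⊗⋆ B) : (a + b) * c = a * c + b * c := by
  induction a using induction₁
  case hp => exact isClosed_eq (by fun_prop) (by fun_prop)
  rename_i a
  induction b using induction₁
  case hp => exact isClosed_eq (by fun_prop) (by fun_prop)
  rename_i b
  induction c using induction₁
  case hp => exact isClosed_eq (by fun_prop) (by fun_prop)
  simp only [← ofPre_mul, ← map_add, add_mul]

variable {A B} in
protected theorem zero_mul (a : A ⊗⋆ B) : 0 * a = 0 := by
  induction a using induction₁
  case hp => exact isClosed_eq (by fun_prop) (by fun_prop)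
  rw [← map_zero (ofPre A B), ← ofPre_mul, zero_mul]

variable {A B} in
protected theorem mul_zero (a : A ⊗⋆ B) : a * 0 = 0 := by
  induction a using induction₁
  case hp => exact isClosed_eq (by fun_prop) (by fun_prop)
  rw [← map_zero (ofPre A B), ← ofPre_mul, mul_zero]

variable {A B} in
protected theorem smul_mul (c : ℂ) (a b : A ⊗⋆ B) : (c • a) * b = c • (a * b) := by
  induction a using induction₁
  case hp =>
    exact isClosed_eq (by exact Continuous.mul (Continuous.const_smul (continuous_id) c) (continuous_const))
      (by exact Continuous.const_smul (Continuous.mul (continuous_id) (continuous_const)) c)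
  rename_i a
  induction b using induction₁
  case hp =>
    exact isClosed_eq (by exact Continuous.mul (continuous_const) (continuous_id))
      (by exact Continuous.const_smul (Continuous.mul (continuous_const) (continuous_id)) c)
  simp only [← ofPre_mul, ← map_smul, smul_mul_assoc]

variable {A B} in
protected theorem mul_smul (c : ℂ) (a b : A ⊗⋆ B) : c • (a * b) = a * (c • b) := by
  induction a using induction₁
  case hp =>
    exact isClosed_eq (by exact Continuous.const_smul (Continuous.mul (continuous_id) (continuous_const)) c)
      (by exact Continuous.mul (continuous_id) (continuous_const))
  rename_i a
  induction b using induction₁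
  case hp =>
    exact isClosed_eq (by exact Continuous.const_smul (Continuous.mul (continuous_const) (continuous_id)) c)
      (by exact Continuous.mul (continuous_const) (Continuous.const_smul (continuous_id) c))
  simp only [← ofPre_mul, ← map_smul, mul_smul_comm]

instance : NonUnitalRing (A ⊗⋆ B) where
  __ := (inferInstance : AddCommGroup (A ⊗⋆ B))
  zero_mul := CStarTensor.zero_mul
  mul_zero := CStarTensor.mul_zero
  mul_assoc := CStarTensor.mul_assoc
  left_distrib := CStarTensor.mul_add
  right_distrib := CStarTensor.add_mul

instance : StarRing (A ⊗⋆ B) where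
  star_involutive a := by
    induction a using induction₁
    case hp => exact isClosed_eq (by fun_prop) (by fun_prop)
    rename_i a
    rw [← ofPre_star, ← ofPre_star, star_star]
  star_mul a b := by
    induction a using induction₁
    case hp => exact isClosed_eq (by fun_prop) (by fun_prop)
    rename_i a
    induction b using induction₁
    case hp => exact isClosed_eq (by fun_prop) (by fun_prop)
    rename_i b
    simp only [← ofPre_star, ← ofPre_mul, star_mul]
  star_add a b := by
    induction a using induction₁
    case hp => exact isClosed_eq (by fun_prop) (by fun_prop)
    rename_i a
    induction b using induction₁
    case hp => exact isClosed_eq (by fun_prop) (by fun_prop)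
    rename_i b
    simp only [← ofPre_star, ← map_add, star_add]

instance : NonUnitalCStarAlgebra (A ⊗⋆ B) where
  __ := (inferInstance : NormedAddCommGroup (A ⊗⋆ B))
  __ := (inferInstance : NonUnitalRing (A ⊗⋆ B))
  __ := (inferInstance : StarRing (A ⊗⋆ B))
  __ := (inferInstance : NormedSpace ℂ (A ⊗⋆ B))
  complete := (inferInstance : CompleteSpace (A ⊗⋆ B)).complete
  norm_mul_le a b := by
    induction a using induction₁
    case hp => exact isClosed_le (by fun_prop) (by fun_prop)
    rename_i a
    induction b using induction₁
    case hp => exact isClosed_le (by fun_prop) (by fun_prop)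
    rename_i b
    simp only [← ofPre_mul, LinearIsometry.norm_map]
    exact norm_mul_le a b
  norm_mul_self_le a := by
    induction a using induction₁
    case hp => exact isClosed_le (by fun_prop) (by fun_prop)
    rename_i a
    simp only [← ofPre_star, ← ofPre_mul, LinearIsometry.norm_map]
    exact PreCStarTensor.norm_mul_self_le A B a
  smul_assoc := CStarTensor.smul_mul
  smul_comm := CStarTensor.mul_smul
  star_smul c a := by
    induction a using induction₁
    case hp =>
      exact isClosed_eq (by exact Continuous.star (Continuous.const_smul (continuous_id) c))
        (by exact Continuous.const_smul (Continuous.star continuous_id) (star c))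
    rename_i a
    simp only [← ofPre_star, ← map_smul, star_smul]

end Instances

end CStarTensor

/-! ### Extension of actions to multipliers -/

namespace MultiplierTools

theorem ext_fst {S : Type*} [NonUnitalCStarAlgebra S] {m n : 𝓜(ℂ, S)}
    (h : ∀ x, m.fst x = n.fst x) : m = n := by
  have h1 : m.fst = n.fst := ContinuousLinearMap.ext h
  have h2 : m - n = 0 := by
    rw [← norm_eq_zero, ← DoubleCentralizer.norm_fst, DoubleCentralizer.sub_fst, h1, sub_self,
      norm_zero]
  exact sub_eq_zero.1 h2

section Action

variable {M : Type*} {W : Type*} {S : Type*} [CStarAlgebra M] [AddCommGroup W] [Module ℂ W]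
  [NonUnitalCStarAlgebra S] (ρ : M →ₐ[ℂ] Module.End ℂ W) (q : W →ₗ[ℂ] S)

/-- The adjointness condition for an action of `M` on a space `W` mapping to a C⋆-algebra. -/
def IsStarAction : Prop :=
  ∀ (m : M) (x y : W), star (q (ρ m x)) * q y = star (q x) * q (ρ (star m) y)

variable {ρ q}

theorem IsStarAction.norm_le (h : IsStarAction ρ q) (m : M) (x : W) :
    ‖q (ρ m x)‖ ≤ ‖m‖ * ‖q x‖ := by
  let _ : PartialOrder M := CStarAlgebra.spectralOrder M
  let _ : StarOrderedRing M := CStarAlgebra.spectralOrderedRing M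
  let _ : PartialOrder S := CStarAlgebra.spectralOrder S
  let _ : StarOrderedRing S := CStarAlgebra.spectralOrderedRing S
  have h0 : 0 ≤ algebraMap ℝ M (‖m‖ ^ 2) - star m * m :=
    sub_nonneg.2 CStarAlgebra.star_mul_le_algebraMap_norm_sq
  obtain ⟨c, hc⟩ := CStarAlgebra.nonneg_iff_eq_star_mul_self.1 h0
  have e1 : ∀ n : M, star (q (ρ n x)) * q (ρ n x) = star (q x) * q (ρ (star n * n) x) := by
    intro n
    rw [h, map_mul]
    rfl
  have e2 : star (q (ρ m x)) * q (ρ m x) + star (q (ρ c x)) * q (ρ c x)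
      = (‖m‖ ^ 2 : ℝ) • (star (q x) * q x) := by
    rw [e1, e1, ← hc, ← mul_add, ← map_add, ← LinearMap.add_apply, ← map_add]
    have : star m * m + (algebraMap ℝ M (‖m‖ ^ 2) - star m * m)
        = algebraMap ℂ M ((‖m‖ ^ 2 : ℝ) : ℂ) := by
      rw [add_sub_cancel]
      rfl
    rw [this, AlgHom.commutes, Module.algebraMap_end_apply, map_smul, mul_smul_comm]
    rfl
  have e3 : star (q (ρ m x)) * q (ρ m x) ≤ (‖m‖ ^ 2 : ℝ) • (star (q x) * q x) := by
    rw [← e2]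
    exact le_add_of_nonneg_right (star_mul_self_nonneg _)
  have e4 := CStarAlgebra.norm_le_norm_of_nonneg_of_le (star_mul_self_nonneg _) e3
  rw [CStarRing.norm_star_mul_self, norm_smul, CStarRing.norm_star_mul_self, Real.norm_eq_abs,
    abs_of_nonneg (sq_nonneg _)] at e4
  refine le_of_sq_le_sq ?_ (by positivity)
  nlinarith

theorem IsStarAction.bound (h : IsStarAction ρ q) (m : M) :
    ∃ C : ℝ, ∀ x, ‖(q ∘ₗ ρ m) x‖ ≤ C * ‖q x‖ :=
  ⟨‖m‖, h.norm_le m⟩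

variable (ρ q) in
/-- The operator on `S` extending `q x ↦ q (m x)`. -/
def actionL (m : M) : S →L[ℂ] S := (q ∘ₗ (ρ m : W →ₗ[ℂ] W)).extendOfNorm q

theorem IsStarAction.actionL_apply (h : IsStarAction ρ q) (hq : DenseRange q) (m : M) (x : W) :
    actionL ρ q m (q x) = q (ρ m x) :=
  LinearMap.extendOfNorm_eq hq (h.bound m) x

theorem IsStarAction.central (h : IsStarAction ρ q) (hq : DenseRange q) (m : M) (x y : S) :
    star (actionL ρ q (star m) (star x)) * y = x * actionL ρ q m y := by
  obtain ⟨x, rfl⟩ : ∃ z, star z = x := ⟨star x, star_star x⟩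
  rw [star_star]
  refine hq.induction_on (p := fun x => star (actionL ρ q (star m) x) * y
    = star x * actionL ρ q m y) x ?_ fun u => ?_
  · exact isClosed_eq (by fun_prop) (by fun_prop)
  · refine hq.induction_on (p := fun y => star (actionL ρ q (star m) (q u)) * y
      = star (q u) * actionL ρ q m y) y ?_ fun v => ?_
    · exact isClosed_eq (by fun_prop) (by fun_prop)
    · rw [h.actionL_apply hq, h.actionL_apply hq, h, star_star]

/-- A star action of `M` on `W`, transported along a map `q : W → S` with dense range, gives a
unital ⋆-homomorphism of `M` into the multiplier algebra of `S`. -/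
def IsStarAction.toMultiplier (h : IsStarAction ρ q) (hq : DenseRange q) : M →⋆ₐ[ℂ] 𝓜(ℂ, S) where
  toFun m :=
    { fst := actionL ρ q m
      snd := (((starₗᵢ ℂ : S ≃ₗᵢ⋆[ℂ] S) : S →L⋆[ℂ] S).comp (actionL ρ q (star m))).comp
          ((starₗᵢ ℂ : S ≃ₗᵢ⋆[ℂ] S) : S →L⋆[ℂ] S)
      central := h.central hq m }
  map_one' := ext_fst fun x => by
    refine hq.induction_on (p := fun x => actionL ρ q 1 x = x) x ?_ fun u => ?_
    · exact isClosed_eq (by fun_prop) (by fun_prop)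
    · rw [h.actionL_apply hq, map_one]
      rfl
  map_mul' m n := ext_fst fun x => by
    refine hq.induction_on
      (p := fun x => actionL ρ q (m * n) x = actionL ρ q m (actionL ρ q n x)) x ?_ fun u => ?_
    · exact isClosed_eq (by fun_prop) (by fun_prop)
    · rw [h.actionL_apply hq, h.actionL_apply hq, h.actionL_apply hq, map_mul]
      rfl
  map_zero' := ext_fst fun x => by
    refine hq.induction_on (p := fun x => actionL ρ q 0 x = 0) x ?_ fun u => ?_
    · exact isClosed_eq (by fun_prop) (by fun_prop)
    · rw [h.actionL_apply hq, map_zero, LinearMap.zero_apply, map_zero]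
  map_add' m n := ext_fst fun x => by
    refine hq.induction_on
      (p := fun x => actionL ρ q (m + n) x = actionL ρ q m x + actionL ρ q n x) x ?_ fun u => ?_
    · exact isClosed_eq (by fun_prop) (by fun_prop)
    · rw [h.actionL_apply hq, h.actionL_apply hq, h.actionL_apply hq, map_add,
        LinearMap.add_apply, map_add]
  commutes' c := ext_fst fun x => by
    refine hq.induction_on
      (p := fun x => actionL ρ q (algebraMap ℂ M c) x = c • x) x ?_ fun u => ?_
    · exact isClosed_eq (by fun_prop) (by fun_prop)
    · rw [h.actionL_apply hq, AlgHom.commutes, Module.algebraMap_end_apply, map_smul]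
  map_star' m := ext_fst fun x => by
    change actionL ρ q (star m) x = star (star (actionL ρ q (star m) (star (star x))))
    rw [star_star, star_star]

theorem IsStarAction.toMultiplier_fst (h : IsStarAction ρ q) (hq : DenseRange q) (m : M) (x : W) :
    (h.toMultiplier hq m).fst (q x) = q (ρ m x) :=
  h.actionL_apply hq m x

end Action

theorem star_fst_mul {S : Type*} [NonUnitalCStarAlgebra S] (m n : 𝓜(ℂ, S)) (x y : S) :
    star (m.fst x) * n.fst y = star x * (star m * n).fst y := by
  have := (star m).central (star x) (n.fst y)
  rw [DoubleCentralizer.star_snd, star_star] at this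
  rw [this]
  rfl

end MultiplierTools

open MultiplierTools

/-! ### Nondegenerate homomorphisms and their extension to the multiplier algebra -/

section Nondegenerate

variable {A : Type u} {S : Type v} [NonUnitalCStarAlgebra A] [NonUnitalCStarAlgebra S]

/-- A ⋆-homomorphism `φ` of `A` into the multiplier algebra of `S` is nondegenerate if the linear
span of `φ(A)S` is dense in `S`. -/
def IsNondegenerate (φ : A →⋆ₙₐ[ℂ] 𝓜(ℂ, S)) : Prop :=
  Dense (Submodule.span ℂ {z : S | ∃ (a : A) (x : S), (φ a).fst x = z} : Set S)

/-- The left action of the multiplier algebra of `A` on the algebraic tensor product `A ⊗ S`. -/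
def leftAction (A : Type u) (S : Type v) [NonUnitalCStarAlgebra A] [NonUnitalCStarAlgebra S] :
    𝓜(ℂ, A) →ₐ[ℂ] Module.End ℂ (A ⊗[ℂ] S) :=
  AlgHom.ofLinearMap
    { toFun := fun m => TensorProduct.map (m.fst : A →ₗ[ℂ] A) LinearMap.id
      map_add' := fun m n => TensorProduct.ext' fun a b => by simp [TensorProduct.add_tmul]
      map_smul' := fun c m => TensorProduct.ext' fun a b => by
        simp [TensorProduct.smul_tmul'] }
    (TensorProduct.ext' fun a b => by simp)
    (fun m n => TensorProduct.ext' fun a b => by simp)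

/-- The right action of the multiplier algebra of `S` on the algebraic tensor product `A ⊗ S`. -/
def rightAction (A : Type u) (S : Type v) [NonUnitalCStarAlgebra A] [NonUnitalCStarAlgebra S] :
    𝓜(ℂ, S) →ₐ[ℂ] Module.End ℂ (A ⊗[ℂ] S) :=
  AlgHom.ofLinearMap
    { toFun := fun m => TensorProduct.map LinearMap.id (m.fst : S →ₗ[ℂ] S)
      map_add' := fun m n => TensorProduct.ext' fun a b => by simp [TensorProduct.tmul_add]
      map_smul' := fun c m => TensorProduct.ext' fun a b => by simp }
    (TensorProduct.ext' fun a b => by simp)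
    (fun m n => TensorProduct.ext' fun a b => by simp)

/-- The linear map `A ⊗ S → S` given by `a ⊗ x ↦ φ(a)x`. -/
def evalMap (φ : A →⋆ₙₐ[ℂ] 𝓜(ℂ, S)) : A ⊗[ℂ] S →ₗ[ℂ] S :=
  TensorProduct.lift
    { toFun := fun a => ((φ a).fst : S →ₗ[ℂ] S)
      map_add' := fun a b => by ext x; simp
      map_smul' := fun c a => by ext x; simp }

@[simp]
theorem evalMap_tmul (φ : A →⋆ₙₐ[ℂ] 𝓜(ℂ, S)) (a : A) (x : S) :
    evalMap φ (a ⊗ₜ[ℂ] x) = (φ a).fst x := rfl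

theorem isStarAction_evalMap (φ : A →⋆ₙₐ[ℂ] 𝓜(ℂ, S)) :
    IsStarAction (leftAction A S) (evalMap φ) := by
  intro m x y
  induction x with
  | zero => simp
  | add x x' hx hx' => simp only [map_add, star_add, add_mul, hx, hx']
  | tmul a s =>
    induction y with
    | zero => simp
    | add y y' hy hy' => simp only [map_add, mul_add, hy, hy']
    | tmul b t =>
      change star ((φ (m.fst a)).fst s) * (φ b).fst t = star ((φ a).fst s) * (φ ((star m).fst b)).fst t
      have := (star m).central (star a) b
      rw [DoubleCentralizer.star_snd, star_star] at this
      rw [star_fst_mul, star_fst_mul, ← map_star φ, ← map_star φ, ← map_mul φ, ← map_mul φ, this]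

theorem IsNondegenerate.denseRange {φ : A →⋆ₙₐ[ℂ] 𝓜(ℂ, S)} (hφ : IsNondegenerate φ) :
    DenseRange (evalMap φ) := by
  refine Dense.mono ?_ hφ
  have : Submodule.span ℂ {z : S | ∃ (a : A) (x : S), (φ a).fst x = z}
      ≤ LinearMap.range (evalMap φ) := by
    rw [Submodule.span_le]
    rintro _ ⟨a, x, rfl⟩
    exact ⟨a ⊗ₜ x, rfl⟩
  exact this

/-- The unique extension of a nondegenerate ⋆-homomorphism `A → M(S)` to a ⋆-homomorphism
`M(A) → M(S)`; it is determined by `φ(m)(φ(a)x) = φ(ma)x`. -/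
def IsNondegenerate.extend {φ : A →⋆ₙₐ[ℂ] 𝓜(ℂ, S)} (hφ : IsNondegenerate φ) :
    𝓜(ℂ, A) →⋆ₐ[ℂ] 𝓜(ℂ, S) :=
  (isStarAction_evalMap φ).toMultiplier hφ.denseRange

theorem IsNondegenerate.extend_fst {φ : A →⋆ₙₐ[ℂ] 𝓜(ℂ, S)} (hφ : IsNondegenerate φ)
    (m : 𝓜(ℂ, A)) (a : A) (x : S) :
    (hφ.extend m).fst ((φ a).fst x) = (φ (m.fst a)).fst x :=
  (isStarAction_evalMap φ).toMultiplier_fst hφ.denseRange m (a ⊗ₜ x)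

/-- The extension indeed extends `φ`. -/
theorem IsNondegenerate.extend_coe {φ : A →⋆ₙₐ[ℂ] 𝓜(ℂ, S)} (hφ : IsNondegenerate φ) (a : A) :
    hφ.extend (a : 𝓜(ℂ, A)) = φ a := by
  refine ext_fst fun x => ?_
  refine hφ.denseRange.induction_on
    (p := fun x => (hφ.extend (a : 𝓜(ℂ, A))).fst x = (φ a).fst x) x ?_ fun u => ?_
  · exact isClosed_eq (by fun_prop) (by fun_prop)
  · induction u with
    | zero => simp
    | add u v hu hv => simp only [map_add, hu, hv]
    | tmul b y =>
      rw [evalMap_tmul, hφ.extend_fst, DoubleCentralizer.coe_fst, ContinuousLinearMap.mul_apply',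
        map_mul]
      rfl

end Nondegenerate

/-! ### Legs and the universal property of the C⋆-tensor product -/

namespace CStarTensor

section Legs

variable (A : Type u) (B : Type v) [NonUnitalCStarAlgebra A] [NonUnitalCStarAlgebra B]

/-- The canonical linear map of the algebraic tensor product into the C⋆-tensor product. -/
def ofAlg : A ⊗[ℂ] B →ₗ[ℂ] A ⊗⋆ B := (ofPre A B).toLinearMap

theorem denseRange_ofAlg : DenseRange (ofAlg A B) := denseRange_ofPre A B

theorem ofAlg_mul (x y : A ⊗[ℂ] B) : ofAlg A B (x * y) = ofAlg A B x * ofAlg A B y :=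
  ofPre_mul A B x y

theorem ofAlg_star (x : A ⊗[ℂ] B) : ofAlg A B (star x) = star (ofAlg A B x) :=
  ofPre_star A B x

theorem norm_ofAlg (x : A ⊗[ℂ] B) : ‖ofAlg A B x‖ = maxNorm x :=
  (ofPre A B).norm_map x

variable {A B} in
/-- The elementary tensor `a ⊗ b` in the C⋆-tensor product. -/
def tmul (a : A) (b : B) : A ⊗⋆ B := ofAlg A B (a ⊗ₜ[ℂ] b)

variable {A B} in
theorem star_tmul_mul_tmul (a a' : A) (b b' : B) :
    star (tmul a b) * tmul a' b' = tmul (star a * a') (star b * b') := by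
  simp only [tmul, ← ofAlg_star, ← ofAlg_mul, TensorProduct.star_tmul,
    Algebra.TensorProduct.tmul_mul_tmul]

theorem isStarAction_left : IsStarAction (leftAction A B) (ofAlg A B) := by
  intro m x y
  induction x with
  | zero => simp
  | add x x' hx hx' => simp only [map_add, star_add, add_mul, hx, hx']
  | tmul a s =>
    induction y with
    | zero => simp
    | add y y' hy hy' => simp only [map_add, mul_add, hy, hy']
    | tmul b t =>
      change star (tmul (m.fst a) s) * tmul b t = star (tmul a s) * tmul ((star m).fst b) t
      rw [star_tmul_mul_tmul, star_tmul_mul_tmul]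
      have := (star m).central (star a) b
      rw [DoubleCentralizer.star_snd, star_star] at this
      rw [this]

theorem isStarAction_right : IsStarAction (rightAction A B) (ofAlg A B) := by
  intro m x y
  induction x with
  | zero => simp
  | add x x' hx hx' => simp only [map_add, star_add, add_mul, hx, hx']
  | tmul a s =>
    induction y with
    | zero => simp
    | add y y' hy hy' => simp only [map_add, mul_add, hy, hy']
    | tmul b t =>
      change star (tmul a (m.fst s)) * tmul b t = star (tmul a s) * tmul b ((star m).fst t)
      rw [star_tmul_mul_tmul, star_tmul_mul_tmul]
      have := (star m).central (star s) t
      rw [DoubleCentralizer.star_snd, star_star] at this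
      rw [this]

/-- The embedding `m ↦ m ⊗ 1` of `M(A)` into `M(A ⊗ B)`, where `(m ⊗ 1)(a ⊗ b) = ma ⊗ b`. -/
def leftLeg : 𝓜(ℂ, A) →⋆ₐ[ℂ] 𝓜(ℂ, A ⊗⋆ B) :=
  (isStarAction_left A B).toMultiplier (denseRange_ofAlg A B)

/-- The embedding `m ↦ 1 ⊗ m` of `M(B)` into `M(A ⊗ B)`, where `(1 ⊗ m)(a ⊗ b) = a ⊗ mb`. -/
def rightLeg : 𝓜(ℂ, B) →⋆ₐ[ℂ] 𝓜(ℂ, A ⊗⋆ B) :=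
  (isStarAction_right A B).toMultiplier (denseRange_ofAlg A B)

variable {A B}

theorem leftLeg_fst_tmul (m : 𝓜(ℂ, A)) (a : A) (b : B) :
    (leftLeg A B m).fst (tmul a b) = tmul (m.fst a) b :=
  (isStarAction_left A B).toMultiplier_fst (denseRange_ofAlg A B) m (a ⊗ₜ b)

theorem rightLeg_fst_tmul (m : 𝓜(ℂ, B)) (a : A) (b : B) :
    (rightLeg A B m).fst (tmul a b) = tmul a (m.fst b) :=
  (isStarAction_right A B).toMultiplier_fst (denseRange_ofAlg A B) m (a ⊗ₜ b)

/-- Continuous linear maps out of the C⋆-tensor product are determined by elementary tensors. -/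
theorem clm_ext {E : Type*} [NormedAddCommGroup E] [NormedSpace ℂ E] {f g : A ⊗⋆ B →L[ℂ] E}
    (h : ∀ a b, f (tmul a b) = g (tmul a b)) (x : A ⊗⋆ B) : f x = g x := by
  refine (denseRange_ofAlg A B).induction_on (p := fun x => f x = g x) x ?_ fun u => ?_
  · exact isClosed_eq f.continuous g.continuous
  · induction u with
    | zero => simp
    | add u v hu hv => simp only [map_add, hu, hv]
    | tmul a b => exact h a b

theorem commute_legs (m : 𝓜(ℂ, A)) (n : 𝓜(ℂ, B)) :
    Commute (leftLeg A B m) (rightLeg A B n) :=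
  ext_fst fun x => clm_ext (f := (leftLeg A B m * rightLeg A B n).fst)
    (g := (rightLeg A B n * leftLeg A B m).fst) (fun a b => by
      change (leftLeg A B m).fst ((rightLeg A B n).fst (tmul a b))
        = (rightLeg A B n).fst ((leftLeg A B m).fst (tmul a b))
      rw [leftLeg_fst_tmul, rightLeg_fst_tmul, leftLeg_fst_tmul, rightLeg_fst_tmul]) x

theorem tmul_mul_tmul (a a' : A) (b b' : B) :
    tmul a b * tmul a' b' = tmul (a * a') (b * b') := by
  simp only [tmul, ← ofAlg_mul, Algebra.TensorProduct.tmul_mul_tmul]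

theorem leftLeg_mul_rightLeg (a : A) (b : B) :
    leftLeg A B (a : 𝓜(ℂ, A)) * rightLeg A B (b : 𝓜(ℂ, B)) = (tmul a b : 𝓜(ℂ, A ⊗⋆ B)) :=
  ext_fst fun x => clm_ext (f := (leftLeg A B (a : 𝓜(ℂ, A)) * rightLeg A B (b : 𝓜(ℂ, B))).fst)
    (g := (tmul a b : 𝓜(ℂ, A ⊗⋆ B)).fst) (fun a' b' => by
      change (leftLeg A B a).fst ((rightLeg A B b).fst (tmul a' b')) = tmul a b * tmul a' b'
      rw [rightLeg_fst_tmul, leftLeg_fst_tmul, tmul_mul_tmul]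
      rfl) x

end Legs

section Lift

variable {A : Type u} {B : Type v} {C : Type w} [NonUnitalCStarAlgebra A] [NonUnitalCStarAlgebra B]
  [NonUnitalCStarAlgebra C] (φ : A →⋆ₙₐ[ℂ] C) (ψ : B →⋆ₙₐ[ℂ] C)

/-- The linear map `a ⊗ b ↦ φ(a)ψ(b)` on the algebraic tensor product. -/
def liftAlg : A ⊗[ℂ] B →ₗ[ℂ] C :=
  TensorProduct.lift (LinearMap.mk₂ ℂ (fun a b => φ a * ψ b)
    (by intros; simp [add_mul]) (by intros; simp [smul_mul_assoc])
    (by intros; simp [mul_add]) (by intros; simp [mul_smul_comm]))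

@[simp]
theorem liftAlg_tmul (a : A) (b : B) : liftAlg φ ψ (a ⊗ₜ[ℂ] b) = φ a * ψ b := rfl

variable {φ ψ}

theorem liftAlg_mul (h : ∀ a b, Commute (φ a) (ψ b)) (x y : A ⊗[ℂ] B) :
    liftAlg φ ψ (x * y) = liftAlg φ ψ x * liftAlg φ ψ y := by
  induction x with
  | zero => simp
  | add x x' hx hx' => simp only [map_add, add_mul, hx, hx']
  | tmul a b =>
    induction y with
    | zero => simp
    | add y y' hy hy' => simp only [map_add, mul_add, hy, hy']
    | tmul a' b' =>
      rw [Algebra.TensorProduct.tmul_mul_tmul, liftAlg_tmul, liftAlg_tmul, liftAlg_tmul, map_mul,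
        map_mul, mul_assoc, mul_assoc, ← mul_assoc (φ a') (ψ b), (h a' b).eq, mul_assoc]

theorem liftAlg_star (h : ∀ a b, Commute (φ a) (ψ b)) (x : A ⊗[ℂ] B) :
    liftAlg φ ψ (star x) = star (liftAlg φ ψ x) := by
  induction x with
  | zero => simp
  | add x x' hx hx' => simp only [map_add, star_add, hx, hx']
  | tmul a b =>
    rw [TensorProduct.star_tmul, liftAlg_tmul, liftAlg_tmul, star_mul, ← map_star, ← map_star,
      (h _ _).eq]

/-- The C⋆-seminorm of a pair of commuting homomorphisms. -/
def pairSeminorm (h : ∀ a b, Commute (φ a) (ψ b)) : CStarSeminorm A B where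
  toSeminorm := (normSeminorm ℂ C).comp (liftAlg φ ψ)
  mul_le' x y := by
    simp only [Seminorm.comp_apply, coe_normSeminorm, liftAlg_mul h]
    exact norm_mul_le _ _
  star_mul_self' x := by
    simp only [Seminorm.comp_apply, coe_normSeminorm, liftAlg_mul h, liftAlg_star h]
    exact CStarRing.norm_star_mul_self
  tmul_le' a b := by
    simp only [Seminorm.comp_apply, coe_normSeminorm, liftAlg_tmul]
    exact (norm_mul_le _ _).trans (mul_le_mul (NonUnitalStarAlgHom.norm_apply_le φ a)
      (NonUnitalStarAlgHom.norm_apply_le ψ b) (norm_nonneg _) (norm_nonneg _))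

theorem norm_liftAlg_le (h : ∀ a b, Commute (φ a) (ψ b)) (x : A ⊗[ℂ] B) :
    ‖liftAlg φ ψ x‖ ≤ 1 * ‖ofAlg A B x‖ := by
  rw [one_mul, norm_ofAlg]
  exact le_maxNorm (pairSeminorm h) x

theorem extend_liftAlg (h : ∀ a b, Commute (φ a) (ψ b)) (x : A ⊗[ℂ] B) :
    (liftAlg φ ψ).extendOfNorm (ofAlg A B) (ofAlg A B x) = liftAlg φ ψ x :=
  LinearMap.extendOfNorm_eq (denseRange_ofAlg A B) ⟨1, norm_liftAlg_le h⟩ x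

/-- The ⋆-homomorphism `A ⊗ B → C` with `a ⊗ b ↦ φ(a)ψ(b)`, for ⋆-homomorphisms `φ : A → C` and
`ψ : B → C` with commuting ranges. -/
def lift (φ : A →⋆ₙₐ[ℂ] C) (ψ : B →⋆ₙₐ[ℂ] C) (h : ∀ a b, Commute (φ a) (ψ b)) :
    A ⊗⋆ B →⋆ₙₐ[ℂ] C where
  toFun := (liftAlg φ ψ).extendOfNorm (ofAlg A B)
  map_smul' c x := map_smul _ c x
  map_zero' := map_zero _
  map_add' x y := map_add _ x y
  map_mul' x y := by
    refine (denseRange_ofAlg A B).induction_on₂ (p := fun x y =>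
      (liftAlg φ ψ).extendOfNorm (ofAlg A B) (x * y) = (liftAlg φ ψ).extendOfNorm (ofAlg A B) x
        * (liftAlg φ ψ).extendOfNorm (ofAlg A B) y) ?_ (fun u v => ?_) x y
    · exact isClosed_eq (by fun_prop) (by fun_prop)
    · rw [← ofAlg_mul, extend_liftAlg h, extend_liftAlg h, extend_liftAlg h, liftAlg_mul h]
  map_star' x := by
    refine (denseRange_ofAlg A B).induction_on (p := fun x =>
      (liftAlg φ ψ).extendOfNorm (ofAlg A B) (star x)
        = star ((liftAlg φ ψ).extendOfNorm (ofAlg A B) x)) x ?_ fun u => ?_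
    · exact isClosed_eq (by fun_prop) (by fun_prop)
    · rw [← ofAlg_star, extend_liftAlg h, extend_liftAlg h, liftAlg_star h]

theorem lift_tmul (h : ∀ a b, Commute (φ a) (ψ b)) (a : A) (b : B) :
    lift φ ψ h (tmul a b) = φ a * ψ b :=
  extend_liftAlg h (a ⊗ₜ b)

theorem lift_commute (h : ∀ a b, Commute (φ a) (ψ b)) {c : C} (hφ : ∀ a, Commute (φ a) c)
    (hψ : ∀ b, Commute (ψ b) c) (x : A ⊗⋆ B) : Commute (lift φ ψ h x) c := by
  change (liftAlg φ ψ).extendOfNorm (ofAlg A B) x * c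
    = c * (liftAlg φ ψ).extendOfNorm (ofAlg A B) x
  refine (denseRange_ofAlg A B).induction_on (p := fun x =>
    (liftAlg φ ψ).extendOfNorm (ofAlg A B) x * c
      = c * (liftAlg φ ψ).extendOfNorm (ofAlg A B) x) x ?_ fun u => ?_
  · exact isClosed_eq (by fun_prop) (by fun_prop)
  · rw [extend_liftAlg h]
    induction u with
    | zero => simp
    | add u v hu hv => simp only [map_add, add_mul, mul_add, hu, hv]
    | tmul a b => exact ((hφ a).mul_left (hψ b)).eq

end Lift

section Nondegenerate

variable {A : Type*} {B : Type*} {S : Type*} {T : Type*} [NonUnitalCStarAlgebra A]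
  [NonUnitalCStarAlgebra B] [NonUnitalCStarAlgebra S] [NonUnitalCStarAlgebra T]

theorem _root_.IsNondegenerate.mem_of_forall {φ : A →⋆ₙₐ[ℂ] 𝓜(ℂ, S)} (hφ : IsNondegenerate φ)
    {E : Type*} [NormedAddCommGroup E] [NormedSpace ℂ E] (L : S →L[ℂ] E) {N : Submodule ℂ E}
    (hN : IsClosed (N : Set E)) (h : ∀ a x, L ((φ a).fst x) ∈ N) (x : S) : L x ∈ N := by
  have hc : IsClosed {x : S | L x ∈ N} := hN.preimage L.continuous
  have hs : (Submodule.span ℂ {z : S | ∃ (a : A) (x : S), (φ a).fst x = z} : Set S)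
      ⊆ {x : S | L x ∈ N} := by
    have : Submodule.span ℂ {z : S | ∃ (a : A) (x : S), (φ a).fst x = z}
        ≤ N.comap (L : S →ₗ[ℂ] E) := by
      rw [Submodule.span_le]
      rintro _ ⟨a, x, rfl⟩
      exact h a x
    exact this
  exact hc.closure_subset_iff.2 hs (hφ x)

theorem _root_.isNondegenerate_of_forall {φ : A →⋆ₙₐ[ℂ] 𝓜(ℂ, S)}
    (h : ∀ N : Submodule ℂ S, IsClosed (N : Set S) → (∀ a x, (φ a).fst x ∈ N) → ∀ x, x ∈ N) :
    IsNondegenerate φ := by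
  intro x
  refine h (Submodule.span ℂ _).topologicalClosure (Submodule.isClosed_topologicalClosure _)
    (fun a x => ?_) x
  exact Submodule.le_topologicalClosure _ (Submodule.subset_span ⟨a, x, rfl⟩)

/-- The canonical embedding of a C⋆-algebra into its multiplier algebra is nondegenerate. -/
theorem _root_.isNondegenerate_coeHom (A : Type*) [NonUnitalCStarAlgebra A] :
    IsNondegenerate (DoubleCentralizer.coeHom : A →⋆ₙₐ[ℂ] 𝓜(ℂ, A)) := by
  refine isNondegenerate_of_forall fun N hN h x => ?_
  let _ : PartialOrder A := CStarAlgebra.spectralOrder A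
  let _ : StarOrderedRing A := CStarAlgebra.spectralOrderedRing A
  have ht := (CStarAlgebra.increasingApproximateUnit A).tendsto_mul_right x
  exact hN.mem_of_tendsto ht (Filter.Eventually.of_forall fun e => h _ _)

theorem _root_.IsNondegenerate.lift {φ : A →⋆ₙₐ[ℂ] 𝓜(ℂ, S)} {ψ : B →⋆ₙₐ[ℂ] 𝓜(ℂ, S)}
    (hφ : IsNondegenerate φ) (hψ : IsNondegenerate ψ) (h : ∀ a b, Commute (φ a) (ψ b)) :
    IsNondegenerate (lift φ ψ h) := by
  refine isNondegenerate_of_forall fun N hN hz x => ?_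
  refine hφ.mem_of_forall (ContinuousLinearMap.id ℂ S) hN (fun a x => ?_) x
  refine hψ.mem_of_forall (φ a).fst hN (fun b x => ?_) x
  have := hz (tmul a b) x
  rwa [lift_tmul] at this

theorem norm_tmul_le (a : A) (b : B) : ‖tmul a b‖ ≤ ‖a‖ * ‖b‖ := by
  rw [tmul, norm_ofAlg]
  exact maxNorm_le fun p => p.tmul_le' a b

/-- The map `(a, b) ↦ a ⊗ b`, as a continuous bilinear map. -/
def tmulL : A →L[ℂ] B →L[ℂ] A ⊗⋆ B :=
  LinearMap.mkContinuous₂ (LinearMap.mk₂ ℂ (fun a b => tmul a b)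
    (fun a a' b => by simp [tmul, TensorProduct.add_tmul])
    (fun c a b => by simp [tmul, ← TensorProduct.smul_tmul'])
    (fun a b b' => by simp [tmul, TensorProduct.tmul_add])
    (fun c a b => by simp [tmul])) 1 (fun a b => by rw [one_mul]; exact norm_tmul_le a b)

theorem mem_of_tmul_mem {N : Submodule ℂ (A ⊗⋆ B)} (hN : IsClosed (N : Set (A ⊗⋆ B)))
    (h : ∀ a b, tmul a b ∈ N) (x : A ⊗⋆ B) : x ∈ N := by
  refine (denseRange_ofAlg A B).induction_on (p := fun x => x ∈ N) x hN fun u => ?_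
  induction u with
  | zero => simp
  | add u v hu hv => rw [map_add]; exact N.add_mem hu hv
  | tmul a b => exact h a b

/-- `a ↦ φ(a) ⊗ 1`. -/
def leftHom (T : Type*) [NonUnitalCStarAlgebra T] (φ : A →⋆ₙₐ[ℂ] 𝓜(ℂ, S)) :
    A →⋆ₙₐ[ℂ] 𝓜(ℂ, S ⊗⋆ T) :=
  (leftLeg S T).toNonUnitalStarAlgHom.comp φ

/-- `b ↦ 1 ⊗ ψ(b)`. -/
def rightHom (S : Type*) [NonUnitalCStarAlgebra S] (ψ : B →⋆ₙₐ[ℂ] 𝓜(ℂ, T)) :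
    B →⋆ₙₐ[ℂ] 𝓜(ℂ, S ⊗⋆ T) :=
  (rightLeg S T).toNonUnitalStarAlgHom.comp ψ

theorem leftHom_apply (φ : A →⋆ₙₐ[ℂ] 𝓜(ℂ, S)) (a : A) :
    leftHom T φ a = leftLeg S T (φ a) := rfl

theorem rightHom_apply (ψ : B →⋆ₙₐ[ℂ] 𝓜(ℂ, T)) (b : B) :
    rightHom S ψ b = rightLeg S T (ψ b) := rfl

theorem _root_.IsNondegenerate.leftHom {φ : A →⋆ₙₐ[ℂ] 𝓜(ℂ, S)} (hφ : IsNondegenerate φ) :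
    IsNondegenerate (leftHom T φ) := by
  refine isNondegenerate_of_forall fun N hN h x => mem_of_tmul_mem hN (fun s t => ?_) x
  refine hφ.mem_of_forall (tmulL.flip t) hN (fun a x => ?_) s
  have := h a (tmul x t)
  rwa [leftHom_apply, leftLeg_fst_tmul] at this

theorem _root_.IsNondegenerate.rightHom {ψ : B →⋆ₙₐ[ℂ] 𝓜(ℂ, T)} (hψ : IsNondegenerate ψ) :
    IsNondegenerate (rightHom S ψ) := by
  refine isNondegenerate_of_forall fun N hN h x => mem_of_tmul_mem hN (fun s t => ?_) x
  refine hψ.mem_of_forall (tmulL s) hN (fun b x => ?_) t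
  have := h b (tmul s x)
  rwa [rightHom_apply, rightLeg_fst_tmul] at this

theorem commute_homs (φ : A →⋆ₙₐ[ℂ] 𝓜(ℂ, S)) (ψ : B →⋆ₙₐ[ℂ] 𝓜(ℂ, T)) (a : A) (b : B) :
    Commute (leftHom T φ a) (rightHom S ψ b) :=
  commute_legs (φ a) (ψ b)

/-- The tensor product `φ ⊗ ψ : A ⊗ B → M(S ⊗ T)` of `φ : A → M(S)` and `ψ : B → M(T)`. -/
def map (φ : A →⋆ₙₐ[ℂ] 𝓜(ℂ, S)) (ψ : B →⋆ₙₐ[ℂ] 𝓜(ℂ, T)) : A ⊗⋆ B →⋆ₙₐ[ℂ] 𝓜(ℂ, S ⊗⋆ T) :=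
  lift (leftHom T φ) (rightHom S ψ) (commute_homs φ ψ)

theorem map_tmul_fst_tmul (φ : A →⋆ₙₐ[ℂ] 𝓜(ℂ, S)) (ψ : B →⋆ₙₐ[ℂ] 𝓜(ℂ, T)) (a : A) (b : B)
    (s : S) (t : T) : (map φ ψ (tmul a b)).fst (tmul s t) = tmul ((φ a).fst s) ((ψ b).fst t) := by
  rw [map, lift_tmul]
  change (leftLeg S T (φ a)).fst ((rightLeg S T (ψ b)).fst (tmul s t)) = _
  rw [rightLeg_fst_tmul, leftLeg_fst_tmul]

theorem _root_.IsNondegenerate.map {φ : A →⋆ₙₐ[ℂ] 𝓜(ℂ, S)} {ψ : B →⋆ₙₐ[ℂ] 𝓜(ℂ, T)}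
    (hφ : IsNondegenerate φ) (hψ : IsNondegenerate ψ) : IsNondegenerate (map φ ψ) :=
  hφ.leftHom.lift hψ.rightHom _

/-- The identity homomorphism `ι` of `A`, viewed with values in the multiplier algebra. -/
abbrev idHom (A : Type*) [NonUnitalCStarAlgebra A] : A →⋆ₙₐ[ℂ] 𝓜(ℂ, A) :=
  DoubleCentralizer.coeHom

end Nondegenerate

section Assoc

variable (A : Type*) (B : Type*) (C : Type*) [NonUnitalCStarAlgebra A]
  [NonUnitalCStarAlgebra B] [NonUnitalCStarAlgebra C]

theorem commute_assoc (x : A ⊗⋆ B) (c : C) :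
    Commute (map (idHom A) (leftHom C (idHom B)) x) (rightHom A (rightHom B (idHom C)) c) :=
  lift_commute _ (fun a => commute_homs _ _ a c)
    (fun b => (commute_homs (idHom B) (idHom C) b c).map (rightLeg A (B ⊗⋆ C))) x

/-- The canonical identification of `(A ⊗ B) ⊗ C` with `A ⊗ (B ⊗ C)`, as a homomorphism into the
multiplier algebra of the latter: `(a ⊗ b) ⊗ c ↦ a ⊗ (b ⊗ c)`. -/
def assocHom : (A ⊗⋆ B) ⊗⋆ C →⋆ₙₐ[ℂ] 𝓜(ℂ, A ⊗⋆ (B ⊗⋆ C)) :=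
  lift (map (idHom A) (leftHom C (idHom B))) (rightHom A (rightHom B (idHom C)))
    (commute_assoc A B C)

theorem assocHom_tmul (a : A) (b : B) (c : C) :
    assocHom A B C (tmul (tmul a b) c) = (tmul a (tmul b c) : 𝓜(ℂ, A ⊗⋆ (B ⊗⋆ C))) := by
  rw [← leftLeg_mul_rightLeg, ← leftLeg_mul_rightLeg, map_mul, ← mul_assoc, assocHom, lift_tmul,
    map, lift_tmul]
  rfl

theorem isNondegenerate_assocHom : IsNondegenerate (assocHom A B C) :=
  IsNondegenerate.lift ((isNondegenerate_coeHom A).map (isNondegenerate_coeHom B).leftHom)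
    (isNondegenerate_coeHom C).rightHom.rightHom _

end Assoc

end CStarTensor

/-! ### Comultiplications -/

open CStarTensor

/-- A comultiplication on a C⋆-algebra `A`: a nondegenerate ⋆-homomorphism `Δ : A → M(A ⊗ A)` which
is coassociative, `(Δ ⊗ ι)Δ = (ι ⊗ Δ)Δ`, where `Δ ⊗ ι` and `ι ⊗ Δ` stand for their extensions to
`M(A ⊗ A)` and `(A ⊗ A) ⊗ A` is identified with `A ⊗ (A ⊗ A)`. -/
structure Comultiplication (A : Type u) [NonUnitalCStarAlgebra A] where
  toHom : A →⋆ₙₐ[ℂ] 𝓜(ℂ, A ⊗⋆ A)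
  nondegenerate : IsNondegenerate toHom
  coassoc : ∀ a : A,
    (isNondegenerate_assocHom A A A).extend
        ((nondegenerate.map (isNondegenerate_coeHom A)).extend (toHom a))
      = ((isNondegenerate_coeHom A).map nondegenerate).extend (toHom a)

instance (A : Type u) [NonUnitalCStarAlgebra A] :
    CoeFun (Comultiplication A) fun _ => A → 𝓜(ℂ, A ⊗⋆ A) :=
  ⟨fun Δ => Δ.toHom⟩

/-- A linear subspace of the multiplier algebra of `T` is a dense subspace of `T` if it is contained
in `T` (embedded in its multiplier algebra) and dense in it. -/
def IsDenseSubspaceOf {T : Type u} [NonUnitalCStarAlgebra T] (P : Submodule ℂ 𝓜(ℂ, T)) : Prop :=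
  (∀ m ∈ P, ∃ z : T, (z : 𝓜(ℂ, T)) = m) ∧ Dense {z : T | (z : 𝓜(ℂ, T)) ∈ P}

namespace Comultiplication

variable {A : Type u} [NonUnitalCStarAlgebra A] (Δ : Comultiplication A)

/-- `Δ(A)(1 ⊗ A)`, the linear span of the products `Δ(a)(1 ⊗ b)`. -/
def mulOneTensor : Submodule ℂ 𝓜(ℂ, A ⊗⋆ A) :=
  Submodule.span ℂ {m | ∃ a b : A, Δ a * rightLeg A A (b : 𝓜(ℂ, A)) = m}

/-- `Δ(A)(A ⊗ 1)`, the linear span of the products `Δ(a)(b ⊗ 1)`. -/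
def mulTensorOne : Submodule ℂ 𝓜(ℂ, A ⊗⋆ A) :=
  Submodule.span ℂ {m | ∃ a b : A, Δ a * leftLeg A A (b : 𝓜(ℂ, A)) = m}

end Comultiplication

end

/-!
The group is the character space `X` of `A`. A character `χ` of a C⋆-algebra extends to its
multiplier algebra (`mult`) and can therefore be pulled back along nondegenerate homomorphisms
(`pullback`). In particular the characters of `A ⊗ A` are the products `s ⊗ t` of characters of `A`
(`charHomeomorph`), so Gelfand duality (`gelfandEquiv`) identifies `A` with `C₀(X)` and `A ⊗ A` with
`C₀(X × X)`, and `st = (s ⊗ t) ∘ Δ` (`conv`) defines a continuous product on `X` for which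
`Δ(a)` is the function `(s, t) ↦ a(st)`. Coassociativity, evaluated at `r ⊗ (s ⊗ t)`, says that this
product is associative.

The elements `Δ(a)(1 ⊗ b)` are the functions `(s, t) ↦ a(st)b(t)`. As they belong to `C₀(X × X)`,
the map `T : (s, t) ↦ (st, t)` is proper (`isProperMap_conv`); as they span a dense subspace, `T` is
injective. The range of `T` is closed, and if its complement were nonempty it would contain an open
rectangle, hence there would be nonzero `a` and `b` with `Δ(a)(1 ⊗ b) = 0`; so `T` is surjective
(`surjective_conv`). The density of `Δ(A)(A ⊗ 1)` gives cancellation on the other side. A nonempty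
semigroup with cancellation on both sides and division on one side is a group
(`groupOfCancelOfDivision`), and its inversion is continuous because `T` is a homeomorphism
(`isTopologicalGroup_of_isClosedMap`).
-/

noncomputable section

open WeakDual MultiplierTools CStarTensor

/-! ### Characters of non-unital C⋆-algebras -/

namespace WeakDual.CharacterSpace

variable {A : Type*} [NonUnitalCStarAlgebra A]

theorem exists_apply_ne_zero (χ : characterSpace ℂ A) : ∃ a, χ a ≠ 0 := by
  by_contra! h
  exact χ.2.1 (ContinuousLinearMap.ext h)

theorem nonUnitalAlgHom_map_star (φ : A →ₙₐ[ℂ] ℂ) (a : A) : φ (star a) = star (φ a) := by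
  have := map_star (Unitization.lift φ : Unitization ℂ A →ₐ[ℂ] ℂ) (a : Unitization ℂ A)
  simpa [← Unitization.inr_star] using this

/-- A multiplicative functional on a C⋆-algebra, as a ⋆-homomorphism; it preserves the involution
because its extension to the unitization does. -/
def starHomOfAlgHom (φ : A →ₙₐ[ℂ] ℂ) : A →⋆ₙₐ[ℂ] ℂ :=
  { φ with map_star' := nonUnitalAlgHom_map_star φ }

/-- The character given by a nonzero multiplicative functional, which is automatically
continuous. -/
def ofNonUnitalAlgHom (φ : A →ₙₐ[ℂ] ℂ) (h : ∃ a, φ a ≠ 0) : characterSpace ℂ A :=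
  ⟨StrongDual.toWeakDual ((φ : A →ₗ[ℂ] ℂ).mkContinuous 1 fun a => by
      rw [one_mul]; exact NonUnitalStarAlgHom.norm_apply_le (starHomOfAlgHom φ) a),
    fun h0 => by
      obtain ⟨a, ha⟩ := h
      exact ha (DFunLike.congr_fun h0 a), map_mul φ⟩

/-- A character as a ⋆-homomorphism. -/
def toStarHom (χ : characterSpace ℂ A) : A →⋆ₙₐ[ℂ] ℂ :=
  starHomOfAlgHom (toNonUnitalAlgHom χ)

theorem norm_apply_le (χ : characterSpace ℂ A) (a : A) : ‖χ a‖ ≤ ‖a‖ :=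
  NonUnitalStarAlgHom.norm_apply_le (toStarHom χ) a

theorem continuous_apply (a : A) : Continuous fun χ : characterSpace ℂ A => χ a :=
  (WeakDual.eval_continuous a).comp continuous_subtype_val

theorem continuous_iff {Z : Type*} [TopologicalSpace Z] {f : Z → characterSpace ℂ A} :
    Continuous f ↔ ∀ a, Continuous fun z => f z a :=
  ⟨fun h a => (continuous_apply a).comp h, fun h =>
    Continuous.subtype_mk (WeakDual.continuous_of_continuous_eval h) fun z => (f z).2⟩

/-! ### Extension of characters to multipliers -/

/-- The ratio `χ(mz) / χ(z)` does not depend on `z`, as it equals `χ(wm) / χ(w)` whenever `χ(z)` and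
`χ(w)` are nonzero. -/
theorem apply_fst_mul (χ : characterSpace ℂ A) (m : 𝓜(ℂ, A)) (z w : A) :
    χ (m.fst z) * χ w = χ (m.fst w) * χ z := by
  have key : ∀ z w : A, χ w * χ (m.fst z) = χ (m.snd w) * χ z := fun z w => by
    rw [← map_mul, ← map_mul, m.central]
  obtain ⟨c, hc⟩ := exists_apply_ne_zero χ
  apply mul_left_cancel₀ hc
  linear_combination χ w * key z c - χ z * key w c

/-- The extension of a character `χ` of `A` to the multiplier algebra, determined by
`χ(m) χ(z) = χ(mz)`. -/
def mult (χ : characterSpace ℂ A) : 𝓜(ℂ, A) →ₐ[ℂ] ℂ :=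
  have hw := (exists_apply_ne_zero χ).choose_spec
  AlgHom.ofLinearMap
    { toFun := fun m =>
        χ (m.fst (exists_apply_ne_zero χ).choose) / χ (exists_apply_ne_zero χ).choose
      map_add' := fun m n => by simp [add_div]
      map_smul' := fun c m => by simp [mul_div_assoc] }
    (by simpa using div_self hw)
    (fun m n => by
      have := apply_fst_mul χ m (n.fst (exists_apply_ne_zero χ).choose)
        (exists_apply_ne_zero χ).choose
      simp only [LinearMap.coe_mk, AddHom.coe_mk, DoubleCentralizer.mul_fst,
        mul_apply_eq_comp]
      field_simp
      linear_combination this)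

theorem apply_fst (χ : characterSpace ℂ A) (m : 𝓜(ℂ, A)) (z : A) :
    χ (m.fst z) = mult χ m * χ z := by
  have hw := (exists_apply_ne_zero χ).choose_spec
  change _ = χ (m.fst (exists_apply_ne_zero χ).choose) / χ (exists_apply_ne_zero χ).choose * χ z
  field_simp
  exact apply_fst_mul χ m _ _

theorem mult_eq_of_forall {χ : characterSpace ℂ A} {m : 𝓜(ℂ, A)} {c : ℂ}
    (h : ∀ z, χ (m.fst z) = c * χ z) : mult χ m = c := by
  obtain ⟨z, hz⟩ := exists_apply_ne_zero χ
  exact mul_right_cancel₀ hz ((apply_fst χ m z).symm.trans (h z))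

@[simp]
theorem mult_coe (χ : characterSpace ℂ A) (a : A) : mult χ (a : 𝓜(ℂ, A)) = χ a :=
  mult_eq_of_forall fun z => by simp

theorem continuous_mult (m : 𝓜(ℂ, A)) : Continuous fun χ : characterSpace ℂ A => mult χ m := by
  refine continuous_iff_continuousAt.2 fun χ₀ => ?_
  obtain ⟨z, hz⟩ := exists_apply_ne_zero χ₀
  have h : ∀ᶠ χ : characterSpace ℂ A in nhds χ₀, χ (m.fst z) / χ z = mult χ m := by
    filter_upwards [(continuous_apply z).continuousAt.eventually_ne hz] with χ hχ
    rw [apply_fst, mul_div_cancel_right₀ _ hχ]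
  exact (((continuous_apply _).continuousAt).div (continuous_apply _).continuousAt hz).congr h

/-! ### Pulling characters back along nondegenerate homomorphisms -/

variable {S : Type*} [NonUnitalCStarAlgebra S] {φ : A →⋆ₙₐ[ℂ] 𝓜(ℂ, S)}

/-- The character `χ ∘ φ` of `A`, for a nondegenerate `φ : A → M(S)` and a character `χ` of `S`;
nondegeneracy is what makes it nonzero. -/
def pullback (hφ : IsNondegenerate φ) (χ : characterSpace ℂ S) : characterSpace ℂ A :=
  ofNonUnitalAlgHom ((mult χ : 𝓜(ℂ, S) →ₙₐ[ℂ] ℂ).comp (φ : A →ₙₐ[ℂ] 𝓜(ℂ, S))) <| by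
    by_contra! h
    obtain ⟨z, hz⟩ := exists_apply_ne_zero χ
    refine hz ?_
    have := hφ.mem_of_forall (toCLM χ) (N := (⊥ : Submodule ℂ ℂ)) isClosed_singleton
      (fun a x => ?_) z
    · simpa using this
    · have ha : mult χ (φ a) = 0 := h a
      simp [apply_fst, ha]

theorem pullback_apply (hφ : IsNondegenerate φ) (χ : characterSpace ℂ S) (a : A) :
    pullback hφ χ a = mult χ (φ a) := rfl

theorem continuous_pullback (hφ : IsNondegenerate φ) :
    Continuous (pullback hφ : characterSpace ℂ S → characterSpace ℂ A) :=
  continuous_iff.2 fun a => continuous_mult (φ a)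

/-- Extending homomorphisms to multipliers is compatible with pulling characters back. -/
theorem mult_extend (hφ : IsNondegenerate φ) (χ : characterSpace ℂ S) (m : 𝓜(ℂ, A)) :
    mult χ (hφ.extend m) = mult (pullback hφ χ) m := by
  obtain ⟨a, ha⟩ := exists_apply_ne_zero (pullback hφ χ)
  obtain ⟨z, hz⟩ := exists_apply_ne_zero χ
  have h := congrArg χ (hφ.extend_fst m a z)
  rw [apply_fst, apply_fst, apply_fst χ (φ (m.fst a)), ← pullback_apply hφ, ← pullback_apply hφ,
    apply_fst, mul_assoc] at h
  rw [← mul_assoc, ← mul_assoc] at h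
  exact mul_right_cancel₀ ha (mul_right_cancel₀ hz h)

end WeakDual.CharacterSpace

/-! ### Characters of C⋆-tensor products -/

namespace CStarTensor

open WeakDual.CharacterSpace

variable {A B : Type*} [NonUnitalCStarAlgebra A] [NonUnitalCStarAlgebra B]

/-- The character `s ⊗ t` of `A ⊗ B`, with `(s ⊗ t)(a ⊗ b) = s(a)t(b)`. -/
def tensorChar (s : characterSpace ℂ A) (t : characterSpace ℂ B) : characterSpace ℂ (A ⊗⋆ B) :=
  ofNonUnitalAlgHom (lift (toStarHom s) (toStarHom t) fun _ _ => Commute.all _ _ : A ⊗⋆ B →ₙₐ[ℂ] ℂ)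
    (by
      obtain ⟨a, ha⟩ := exists_apply_ne_zero s
      obtain ⟨b, hb⟩ := exists_apply_ne_zero t
      refine ⟨tmul a b, ?_⟩
      have := lift_tmul (φ := toStarHom s) (ψ := toStarHom t) (fun _ _ => Commute.all _ _) a b
      exact this.trans_ne (mul_ne_zero ha hb))

@[simp]
theorem tensorChar_tmul (s : characterSpace ℂ A) (t : characterSpace ℂ B) (a : A) (b : B) :
    tensorChar s t (tmul a b) = s a * t b :=
  lift_tmul (φ := toStarHom s) (ψ := toStarHom t) (fun _ _ => Commute.all _ _) a b

theorem char_ext {χ ψ : characterSpace ℂ (A ⊗⋆ B)} (h : ∀ a b, χ (tmul a b) = ψ (tmul a b)) :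
    χ = ψ :=
  CharacterSpace.ext fun z => clm_ext (f := toCLM χ) (g := toCLM ψ) h z

theorem continuous_tensorChar :
    Continuous fun p : characterSpace ℂ A × characterSpace ℂ B => tensorChar p.1 p.2 := by
  refine continuous_iff.2 fun z => continuous_of_uniform_approx_of_continuous fun U hU => ?_
  -- characters are contractive, so an algebraic tensor close to `z` gives a uniform approximation
  obtain ⟨ε, hε, hU⟩ := Metric.mem_uniformity_dist.1 hU
  obtain ⟨x, hx⟩ := (denseRange_ofAlg A B).exists_dist_lt z hε
  refine ⟨fun p => tensorChar p.1 p.2 (ofAlg A B x), ?_, fun p => hU ?_⟩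
  · clear hx
    induction x with
    | zero => simpa using continuous_const
    | add x y hx hy => exact (hx.add hy).congr fun p => by simp only [Pi.add_apply, map_add]
    | tmul a b =>
      exact (((CharacterSpace.continuous_apply a).comp continuous_fst).mul
        ((CharacterSpace.continuous_apply b).comp continuous_snd)).congr
          fun p => (tensorChar_tmul _ _ a b).symm
  · rw [dist_eq_norm, ← map_sub]
    exact (norm_apply_le _ _).trans_lt (by rwa [← dist_eq_norm])

theorem mult_leftHom_mul_mult_rightHom (χ : characterSpace ℂ (A ⊗⋆ B)) (a : A) (b : B) :
    mult χ (leftHom B (idHom A) a) * mult χ (rightHom A (idHom B) b) = χ (tmul a b) := by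
  rw [← map_mul, ← mult_coe]
  exact congrArg (mult χ) (leftLeg_mul_rightLeg a b)

variable (A B) in
/-- Every character of `A ⊗ B` is `s ⊗ t` for unique characters `s` of `A` and `t` of `B`, which are
its restrictions to the two legs. -/
def charHomeomorph :
    characterSpace ℂ A × characterSpace ℂ B ≃ₜ characterSpace ℂ (A ⊗⋆ B) where
  toFun p := tensorChar p.1 p.2
  invFun χ := (pullback (isNondegenerate_coeHom A).leftHom χ,
    pullback (isNondegenerate_coeHom B).rightHom χ)
  left_inv p := by
    refine Prod.ext (CharacterSpace.ext fun a => ?_) (CharacterSpace.ext fun b => ?_)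
    · rw [pullback_apply]
      refine mult_eq_of_forall fun z => ?_
      refine clm_ext (f := (toCLM (tensorChar p.1 p.2)).comp (leftHom B (idHom A) a).fst)
        (g := p.1 a • toCLM (tensorChar p.1 p.2)) (fun a' b' => ?_) z
      change tensorChar p.1 p.2 ((leftLeg A B (a : 𝓜(ℂ, A))).fst (tmul a' b')) =
        p.1 a * tensorChar p.1 p.2 (tmul a' b')
      rw [leftLeg_fst_tmul, tensorChar_tmul, tensorChar_tmul, ← mul_assoc, ← map_mul]
      rfl
    · rw [pullback_apply]
      refine mult_eq_of_forall fun z => ?_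
      refine clm_ext (f := (toCLM (tensorChar p.1 p.2)).comp (rightHom A (idHom B) b).fst)
        (g := p.2 b • toCLM (tensorChar p.1 p.2)) (fun a' b' => ?_) z
      change tensorChar p.1 p.2 ((rightLeg A B (b : 𝓜(ℂ, B))).fst (tmul a' b')) =
        p.2 b * tensorChar p.1 p.2 (tmul a' b')
      rw [rightLeg_fst_tmul, tensorChar_tmul, tensorChar_tmul, mul_left_comm, ← map_mul]
      rfl
  right_inv χ := char_ext fun a b => by
    rw [tensorChar_tmul]
    exact mult_leftHom_mul_mult_rightHom χ a b
  continuous_toFun := continuous_tensorChar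
  continuous_invFun := (continuous_pullback _).prodMk (continuous_pullback _)

@[simp]
theorem charHomeomorph_apply (p : characterSpace ℂ A × characterSpace ℂ B) :
    charHomeomorph A B p = tensorChar p.1 p.2 := rfl

theorem mult_tensorChar_leftLeg (s : characterSpace ℂ A) (t : characterSpace ℂ B) (a : A) :
    mult (tensorChar s t) (leftLeg A B (a : 𝓜(ℂ, A))) = s a :=
  DFunLike.congr_fun (congrArg Prod.fst ((charHomeomorph A B).left_inv (s, t))) a

theorem mult_tensorChar_rightLeg (s : characterSpace ℂ A) (t : characterSpace ℂ B) (b : B) :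
    mult (tensorChar s t) (rightLeg A B (b : 𝓜(ℂ, B))) = t b :=
  DFunLike.congr_fun (congrArg Prod.snd ((charHomeomorph A B).left_inv (s, t))) b

variable {S T : Type*} [NonUnitalCStarAlgebra S] [NonUnitalCStarAlgebra T]

theorem pullback_map {φ : A →⋆ₙₐ[ℂ] 𝓜(ℂ, S)} {ψ : B →⋆ₙₐ[ℂ] 𝓜(ℂ, T)} (hφ : IsNondegenerate φ)
    (hψ : IsNondegenerate ψ) (s : characterSpace ℂ S) (t : characterSpace ℂ T) :
    pullback (hφ.map hψ) (tensorChar s t) = tensorChar (pullback hφ s) (pullback hψ t) := by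
  refine char_ext fun a b => ?_
  rw [pullback_apply, tensorChar_tmul, pullback_apply, pullback_apply]
  refine mult_eq_of_forall fun z => ?_
  refine clm_ext (f := (toCLM (tensorChar s t)).comp (map φ ψ (tmul a b)).fst)
    (g := (mult s (φ a) * mult t (ψ b)) • toCLM (tensorChar s t)) (fun x y => ?_) z
  change tensorChar s t ((map φ ψ (tmul a b)).fst (tmul x y)) =
    (mult s (φ a) * mult t (ψ b)) * tensorChar s t (tmul x y)
  rw [map_tmul_fst_tmul, tensorChar_tmul, tensorChar_tmul, apply_fst, apply_fst]
  ring

theorem pullback_coeHom (s : characterSpace ℂ A) : pullback (isNondegenerate_coeHom A) s = s :=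
  CharacterSpace.ext fun a => mult_coe s a

theorem pullback_assocHom {C : Type*} [NonUnitalCStarAlgebra C] (r : characterSpace ℂ A)
    (s : characterSpace ℂ B) (t : characterSpace ℂ C) :
    pullback (isNondegenerate_assocHom A B C) (tensorChar r (tensorChar s t)) =
      tensorChar (tensorChar r s) t := by
  obtain ⟨⟨σ, t'⟩, h⟩ := (charHomeomorph (A ⊗⋆ B) C).surjective
    (pullback (isNondegenerate_assocHom A B C) (tensorChar r (tensorChar s t)))
  obtain ⟨⟨r', s'⟩, rfl⟩ := (charHomeomorph A B).surjective σ
  have key : ∀ a b c, r' a * s' b * t' c = r a * s b * t c := fun a b c => by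
    have := DFunLike.congr_fun h (tmul (tmul a b) c)
    rw [pullback_apply, assocHom_tmul, mult_coe] at this
    simpa [mul_assoc] using this
  rw [← h]
  simp only [charHomeomorph_apply]
  refine char_ext fun x c => ?_
  rw [tensorChar_tmul, tensorChar_tmul, mul_comm, mul_comm _ (t c)]
  refine clm_ext (f := t' c • toCLM (tensorChar r' s')) (g := t c • toCLM (tensorChar r s))
    (fun a b => ?_) x
  change t' c * tensorChar r' s' (tmul a b) = t c * tensorChar r s (tmul a b)
  rw [tensorChar_tmul, tensorChar_tmul, mul_comm, key, mul_comm]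

end CStarTensor

/-! ### Gelfand duality for non-unital abelian C⋆-algebras -/

namespace WeakDual.CharacterSpace

section Noncommutative

variable {A : Type*} [NonUnitalCStarAlgebra A]

/-- The characters that are bounded away from zero at `a` form a compact set: it is closed in the
unit ball of the dual, since `characterSpace ℂ A ∪ {0}` is. -/
theorem isCompact_le_norm_apply (a : A) {ε : ℝ} (hε : 0 < ε) :
    IsCompact {χ : characterSpace ℂ A | ε ≤ ‖χ a‖} := by
  rw [Subtype.isCompact_iff]
  have h : (Subtype.val '' {χ : characterSpace ℂ A | ε ≤ ‖χ a‖} : Set (WeakDual ℂ A)) =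
      (characterSpace ℂ A ∪ {0}) ∩ {φ | ε ≤ ‖φ a‖} ∩
        (WeakDual.toStrongDual ⁻¹' Metric.closedBall 0 1) := by
    ext φ
    constructor
    · rintro ⟨χ, hχ, rfl⟩
      refine ⟨⟨Or.inl χ.2, hχ⟩, ?_⟩
      rw [Set.mem_preimage, mem_closedBall_zero_iff]
      exact ContinuousLinearMap.opNorm_le_bound _ zero_le_one fun x =>
        (norm_apply_le χ x).trans_eq (one_mul _).symm
    · rintro ⟨⟨h | h, h'⟩, -⟩
      · exact ⟨⟨φ, h⟩, h', rfl⟩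
      · rw [Set.mem_singleton_iff] at h
        subst h
        have : ε ≤ ‖(0 : ℂ)‖ := h'
        rw [norm_zero] at this
        exact absurd this hε.not_ge
  rw [h]
  exact (WeakDual.isCompact_closedBall (𝕜 := ℂ) 0 1).inter_left
    ((union_zero_isClosed ℂ A).inter (isClosed_le continuous_const (eval_continuous a).norm))

instance instLocallyCompactSpace : LocallyCompactSpace (characterSpace ℂ A) := by
  have : WeaklyLocallyCompactSpace (characterSpace ℂ A) := ⟨fun χ => by
    obtain ⟨a, ha⟩ := exists_apply_ne_zero χ
    have h0 : 0 < ‖χ a‖ := norm_pos_iff.2 ha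
    exact ⟨_, isCompact_le_norm_apply a (half_pos h0),
      (continuous_apply a).norm.continuousAt.eventually (eventually_ge_nhds (half_lt_self h0))⟩⟩
  infer_instance

/-- The Gelfand transform `a ↦ (χ ↦ χ(a))` with values in the functions vanishing at infinity. -/
def gelfandHom (A : Type*) [NonUnitalCStarAlgebra A] : A →⋆ₙₐ[ℂ] C₀(characterSpace ℂ A, ℂ) where
  toFun a :=
    { toFun := fun χ => χ a
      continuous_toFun := continuous_apply a
      zero_at_infty' := by
        rw [Metric.tendsto_nhds]
        intro ε hε
        filter_upwards [(isCompact_le_norm_apply a hε).compl_mem_cocompact] with χ hχ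
        simpa using hχ }
  map_smul' c a := by ext χ; exact map_smul χ c a
  map_zero' := by ext χ; exact map_zero χ
  map_add' a b := by ext χ; exact map_add χ a b
  map_mul' a b := by ext χ; exact map_mul χ a b
  map_star' a := by ext χ; exact map_star (toStarHom χ) a

@[simp]
theorem gelfandHom_apply (a : A) (χ : characterSpace ℂ A) : gelfandHom A a χ = χ a := rfl

end Noncommutative

variable {A : Type*} [NonUnitalCommCStarAlgebra A]

/-- The restriction to `A` of a character of its unitization, which may be zero. -/
def restrict (ψ : characterSpace ℂ (Unitization ℂ A)) : WeakDual ℂ A :=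
  StrongDual.toWeakDual ((toCLM ψ).comp
    (⟨Unitization.inrHom ℂ ℂ A, Unitization.continuous_inr⟩ : A →L[ℂ] Unitization ℂ A))

theorem restrict_apply (ψ : characterSpace ℂ (Unitization ℂ A)) (a : A) :
    restrict ψ a = ψ (a : Unitization ℂ A) := rfl

theorem restrict_mem {ψ : characterSpace ℂ (Unitization ℂ A)} (h : restrict ψ ≠ 0) :
    restrict ψ ∈ characterSpace ℂ A :=
  ⟨h, fun a b => by rw [restrict_apply, Unitization.inr_mul, map_mul]; rfl⟩

theorem continuous_restrict :
    Continuous (restrict : characterSpace ℂ (Unitization ℂ A) → WeakDual ℂ A) :=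
  WeakDual.continuous_of_continuous_eval fun a => continuous_apply (a : Unitization ℂ A)

/-- The extension of a character to the unitization. -/
def extendUnitization (χ : characterSpace ℂ A) : characterSpace ℂ (Unitization ℂ A) :=
  ofNonUnitalAlgHom (Unitization.lift (toNonUnitalAlgHom χ) : Unitization ℂ A →ₐ[ℂ] ℂ)
    ⟨1, (map_one (Unitization.lift (toNonUnitalAlgHom χ))).trans_ne one_ne_zero⟩

theorem extendUnitization_inr (χ : characterSpace ℂ A) (a : A) :
    extendUnitization χ (a : Unitization ℂ A) = χ a :=
  DFunLike.congr_fun (Unitization.lift.symm_apply_apply (toNonUnitalAlgHom χ)) a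

theorem restrict_extendUnitization (χ : characterSpace ℂ A) :
    restrict (extendUnitization χ) = χ :=
  DFunLike.ext _ _ fun a => (restrict_apply _ a).trans (extendUnitization_inr χ a)

variable (A) in
/-- The character of the unitization that vanishes on `A`. -/
def infinity : characterSpace ℂ (Unitization ℂ A) :=
  ofNonUnitalAlgHom (Unitization.fstHom ℂ A : Unitization ℂ A →ₐ[ℂ] ℂ)
    ⟨1, (map_one (Unitization.fstHom ℂ A)).trans_ne one_ne_zero⟩

theorem infinity_apply (x : Unitization ℂ A) : infinity A x = x.fst := rfl

open Classical in
/-- A function on the characters of `A` which vanishes at infinity, extended by zero to the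
characters of the unitization. -/
def zeroExtend (f : C₀(characterSpace ℂ A, ℂ)) (ψ : characterSpace ℂ (Unitization ℂ A)) : ℂ :=
  if h : restrict ψ ∈ characterSpace ℂ A then f ⟨restrict ψ, h⟩ else 0

theorem zeroExtend_extendUnitization (f : C₀(characterSpace ℂ A, ℂ)) (χ : characterSpace ℂ A) :
    zeroExtend f (extendUnitization χ) = f χ := by
  have h : restrict (extendUnitization χ) ∈ characterSpace ℂ A :=
    (restrict_extendUnitization χ).symm ▸ χ.2
  rw [zeroExtend, dif_pos h]
  exact congrArg f (Subtype.ext (restrict_extendUnitization χ))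

theorem zeroExtend_eq_zero (f : C₀(characterSpace ℂ A, ℂ))
    {ψ : characterSpace ℂ (Unitization ℂ A)} (h : restrict ψ = 0) : zeroExtend f ψ = 0 :=
  dif_neg fun h' => h'.1 h

theorem continuous_zeroExtend (f : C₀(characterSpace ℂ A, ℂ)) : Continuous (zeroExtend f) := by
  refine continuous_iff_continuousAt.2 fun ψ => ?_
  by_cases h : restrict ψ = 0
  · -- near a character that vanishes on `A`, the restrictions avoid a given compact set
    rw [ContinuousAt, zeroExtend_eq_zero f h, Metric.tendsto_nhds]
    intro ε hε
    obtain ⟨K, hK, hKf⟩ := Filter.mem_cocompact.1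
      ((Metric.tendsto_nhds.1 f.zero_at_infty') ε hε)
    have hc : IsClosed (Subtype.val '' K : Set (WeakDual ℂ A)) :=
      (hK.image continuous_subtype_val).isClosed
    have h0 : restrict ψ ∉ (Subtype.val '' K : Set (WeakDual ℂ A)) := by
      rintro ⟨χ, -, hχ⟩
      exact χ.2.1 (hχ.trans h)
    filter_upwards [(hc.isOpen_compl.preimage continuous_restrict).mem_nhds h0] with ψ' hψ'
    rw [zeroExtend]
    split_ifs with h'
    · exact hKf fun hm => hψ' ⟨_, hm, rfl⟩
    · simpa using hε
  · have hU : IsOpen {ψ' : characterSpace ℂ (Unitization ℂ A) | restrict ψ' ≠ 0} :=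
      isOpen_ne.preimage continuous_restrict
    refine ContinuousOn.continuousAt (continuousOn_iff_continuous_domRestrict.2 ?_) (hU.mem_nhds h)
    have hc : Continuous fun ψ' : {ψ' : characterSpace ℂ (Unitization ℂ A) // restrict ψ' ≠ 0} =>
        f ⟨restrict ψ'.1, restrict_mem ψ'.2⟩ :=
      f.continuous.comp (Continuous.subtype_mk (continuous_restrict.comp continuous_subtype_val) _)
    refine hc.congr fun ψ' => ?_
    rw [Set.domRestrict_apply, zeroExtend, dif_pos (restrict_mem ψ'.2)]

theorem eq_zero_of_forall_apply_eq_zero {a : A} (h : ∀ χ : characterSpace ℂ A, χ a = 0) :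
    a = 0 := by
  have h0 : gelfandTransform ℂ (Unitization ℂ A) (a : Unitization ℂ A) = 0 := by
    ext ψ
    change restrict ψ a = 0
    by_cases hψ : restrict ψ = 0
    · rw [hψ]; rfl
    · exact h ⟨_, restrict_mem hψ⟩
  have := (gelfandTransform_bijective (Unitization ℂ A)).1 (h0.trans (map_zero _).symm)
  exact Unitization.inr_injective (this.trans (Unitization.inr_zero ℂ).symm)

/-- This follows from Gelfand duality for the unitization: a function `f` vanishing at infinity,
extended by zero, is the transform of an element whose scalar part, its value at `infinity A`, is
zero. -/
theorem gelfandHom_bijective (A : Type*) [NonUnitalCommCStarAlgebra A] :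
    Function.Bijective (gelfandHom A) := by
  refine ⟨(injective_iff_map_eq_zero _).2 fun a ha =>
    eq_zero_of_forall_apply_eq_zero fun χ => DFunLike.congr_fun ha χ, fun f => ?_⟩
  obtain ⟨x, hx⟩ := (gelfandTransform_bijective (Unitization ℂ A)).2
    ⟨zeroExtend f, continuous_zeroExtend f⟩
  have hx' : ∀ ψ : characterSpace ℂ (Unitization ℂ A), ψ x = zeroExtend f ψ :=
    fun ψ => DFunLike.congr_fun hx ψ
  have hfst : x.fst = 0 := by
    rw [← infinity_apply, hx']
    exact zeroExtend_eq_zero f (DFunLike.ext _ _ fun a => Unitization.fst_inr ℂ a)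
  have hsnd : (x.snd : Unitization ℂ A) = x :=
    Unitization.ext (by rw [Unitization.fst_inr, hfst]) (Unitization.snd_inr ℂ _)
  refine ⟨x.snd, ZeroAtInftyContinuousMap.ext fun χ => ?_⟩
  rw [gelfandHom_apply, ← extendUnitization_inr, hsnd, hx', zeroExtend_extendUnitization]

/-- Gelfand duality: an abelian C⋆-algebra is `C₀` of its character space. -/
def gelfandEquiv (A : Type*) [NonUnitalCommCStarAlgebra A] :
    A ≃⋆ₐ[ℂ] C₀(characterSpace ℂ A, ℂ) :=
  StarAlgEquiv.ofBijective (gelfandHom A) (gelfandHom_bijective A)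

end WeakDual.CharacterSpace

namespace ZeroAtInftyContinuousMap

/-- A homeomorphism of spaces gives an isomorphism of the algebras of functions vanishing at
infinity. -/
def compHomeomorph {X Y : Type*} [TopologicalSpace X] [TopologicalSpace Y] (h : X ≃ₜ Y) :
    C₀(Y, ℂ) ≃⋆ₐ[ℂ] C₀(X, ℂ) where
  toFun f := ⟨(f : C(Y, ℂ)).comp h,
    f.zero_at_infty'.comp h.isClosedEmbedding.tendsto_cocompact⟩
  invFun f := ⟨(f : C(X, ℂ)).comp h.symm,
    f.zero_at_infty'.comp h.symm.isClosedEmbedding.tendsto_cocompact⟩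
  left_inv f := ext fun y => congrArg f (h.apply_symm_apply y)
  right_inv f := ext fun x => congrArg f (h.symm_apply_apply x)
  map_mul' _ _ := rfl
  map_add' _ _ := rfl
  map_star' _ := rfl
  map_smul' _ _ := rfl

end ZeroAtInftyContinuousMap

namespace CStarTensor

/-- The tensor product of abelian C⋆-algebras is abelian. This is not an instance, so that the
algebraic structure of `A ⊗⋆ B` is always found along the same path. -/
abbrev nonUnitalCommCStarAlgebra (A B : Type*) [NonUnitalCommCStarAlgebra A]
    [NonUnitalCommCStarAlgebra B] : NonUnitalCommCStarAlgebra (A ⊗⋆ B) where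
  mul_comm x y := by
    refine (denseRange_ofAlg A B).induction_on₂ (p := fun x y => x * y = y * x) ?_
      (fun u v => ?_) x y
    · exact isClosed_eq (by fun_prop) (by fun_prop)
    · induction u with
      | zero => simp
      | add u u' hu hu' => simp only [map_add, add_mul, mul_add, hu, hu']
      | tmul a b =>
        induction v with
        | zero => simp
        | add v v' hv hv' => simp only [map_add, add_mul, mul_add, hv, hv']
        | tmul a' b' =>
          change tmul a b * tmul a' b' = tmul a' b' * tmul a b
          rw [tmul_mul_tmul, tmul_mul_tmul, mul_comm a, mul_comm b]

/-- The isomorphism of `A ⊗ B` with the functions on pairs of characters. -/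
def gelfandTensorEquiv (A B : Type*) [NonUnitalCommCStarAlgebra A] [NonUnitalCommCStarAlgebra B] :
    A ⊗⋆ B ≃⋆ₐ[ℂ] C₀(characterSpace ℂ A × characterSpace ℂ B, ℂ) :=
  let _ := nonUnitalCommCStarAlgebra A B
  (CharacterSpace.gelfandEquiv (A ⊗⋆ B)).trans
    (ZeroAtInftyContinuousMap.compHomeomorph (charHomeomorph A B))

end CStarTensor

/-! ### Separation properties of characters -/

namespace WeakDual.CharacterSpace

theorem eq_of_isDenseSubspaceOf {T : Type*} [NonUnitalCStarAlgebra T] {M : Set 𝓜(ℂ, T)}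
    (h : IsDenseSubspaceOf (Submodule.span ℂ M)) {χ ψ : characterSpace ℂ T}
    (hM : ∀ m ∈ M, mult χ m = mult ψ m) : χ = ψ := by
  have hs : ∀ m ∈ Submodule.span ℂ M, mult χ m = mult ψ m := fun m hm =>
    LinearMap.eqOn_span (f := (mult χ).toLinearMap) (g := (mult ψ).toLinearMap) hM hm
  have heq : (χ : T → ℂ) = ψ := Continuous.ext_on h.2 (map_continuous χ) (map_continuous ψ)
    fun z hz => by simpa using hs _ hz
  exact DFunLike.coe_injective heq

theorem eq_zero_of_forall_mult_eq_zero {T : Type*} [NonUnitalCommCStarAlgebra T] {m : 𝓜(ℂ, T)}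
    (h : ∀ χ : characterSpace ℂ T, mult χ m = 0) : m = 0 :=
  ext_fst fun z => eq_zero_of_forall_apply_eq_zero fun χ => by rw [apply_fst, h, zero_mul]

/-- Urysohn's lemma, for elements of the algebra as functions on the character space. -/
theorem exists_apply_ne_zero_of_isOpen {A : Type*} [NonUnitalCommCStarAlgebra A]
    {U : Set (characterSpace ℂ A)} (hU : IsOpen U) {x : characterSpace ℂ A} (hx : x ∈ U) :
    ∃ a : A, x a ≠ 0 ∧ ∀ y ∉ U, y a = 0 := by
  obtain ⟨f, hf1, hf0, hfc, -⟩ := exists_continuous_one_zero_of_isCompact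
    (isCompact_singleton (x := x)) hU.isClosed_compl (Set.disjoint_singleton_left.2 fun h => h hx)
  have hfc' : HasCompactSupport fun y => (f y : ℂ) := hfc.comp_left Complex.ofReal_zero
  obtain ⟨a, ha⟩ := (gelfandEquiv A).surjective
    ⟨⟨fun y => (f y : ℂ), Complex.continuous_ofReal.comp f.continuous⟩, hfc'.is_zero_at_infty⟩
  have ha' : ∀ y : characterSpace ℂ A, y a = f y := fun y => DFunLike.congr_fun ha y
  refine ⟨a, ?_, fun y hy => ?_⟩
  · rw [ha', hf1 rfl]; simp
  · rw [ha', hf0 hy]; simp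

instance instNonempty {A : Type*} [NonUnitalCommCStarAlgebra A] [Nontrivial A] :
    Nonempty (characterSpace ℂ A) := by
  by_contra h
  rw [not_nonempty_iff] at h
  obtain ⟨a, ha⟩ := exists_ne (0 : A)
  exact ha (eq_zero_of_forall_apply_eq_zero fun χ => isEmptyElim χ)

end WeakDual.CharacterSpace

/-! ### The product of characters given by a comultiplication -/

namespace Comultiplication

open WeakDual.CharacterSpace

variable {A : Type u}

section Convolution

variable [NonUnitalCStarAlgebra A] (Δ : Comultiplication A)

/-- The product `(s ⊗ t) ∘ Δ` of two characters. -/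
def conv (s t : characterSpace ℂ A) : characterSpace ℂ A :=
  pullback Δ.nondegenerate (tensorChar s t)

theorem conv_apply (s t : characterSpace ℂ A) (a : A) :
    Δ.conv s t a = mult (tensorChar s t) (Δ a) := rfl

theorem continuous_conv :
    Continuous fun p : characterSpace ℂ A × characterSpace ℂ A => Δ.conv p.1 p.2 :=
  (continuous_pullback Δ.nondegenerate).comp continuous_tensorChar

theorem conv_assoc (r s t : characterSpace ℂ A) :
    Δ.conv (Δ.conv r s) t = Δ.conv r (Δ.conv s t) := CharacterSpace.ext fun a => by
  -- both sides of coassociativity are evaluated at the character `r ⊗ (s ⊗ t)`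
  have h := congrArg (mult (tensorChar r (tensorChar s t))) (Δ.coassoc a)
  rw [mult_extend, pullback_assocHom, mult_extend, mult_extend,
    pullback_map Δ.nondegenerate (isNondegenerate_coeHom A),
    pullback_map (isNondegenerate_coeHom A) Δ.nondegenerate, pullback_coeHom, pullback_coeHom] at h
  exact h

theorem mult_mul_rightLeg (s t : characterSpace ℂ A) (a b : A) :
    mult (tensorChar s t) (Δ a * rightLeg A A (b : 𝓜(ℂ, A))) = Δ.conv s t a * t b := by
  rw [map_mul, mult_tensorChar_rightLeg, conv_apply]

theorem mult_mul_leftLeg (s t : characterSpace ℂ A) (a b : A) :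
    mult (tensorChar s t) (Δ a * leftLeg A A (b : 𝓜(ℂ, A))) = Δ.conv s t a * s b := by
  rw [map_mul, mult_tensorChar_leftLeg, conv_apply]

variable {Δ}

/-- The density of `Δ(A)(1 ⊗ A)` says that the functions `(s, t) ↦ a(st)b(t)` separate points. -/
theorem conv_right_cancel (h₁ : IsDenseSubspaceOf Δ.mulOneTensor) {s s' t : characterSpace ℂ A}
    (h : Δ.conv s t = Δ.conv s' t) : s = s' := by
  have : tensorChar s t = tensorChar s' t := eq_of_isDenseSubspaceOf h₁ <| by
    rintro _ ⟨a, b, rfl⟩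
    rw [mult_mul_rightLeg, mult_mul_rightLeg, h]
  exact congrArg Prod.fst ((charHomeomorph A A).injective (a₁ := (s, t)) (a₂ := (s', t)) this)

theorem conv_left_cancel (h₂ : IsDenseSubspaceOf Δ.mulTensorOne) {s t t' : characterSpace ℂ A}
    (h : Δ.conv s t = Δ.conv s t') : t = t' := by
  have : tensorChar s t = tensorChar s t' := eq_of_isDenseSubspaceOf h₂ <| by
    rintro _ ⟨a, b, rfl⟩
    rw [mult_mul_leftLeg, mult_mul_leftLeg, h]
  exact congrArg Prod.snd ((charHomeomorph A A).injective (a₁ := (s, t)) (a₂ := (s, t')) this)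

/-- The containment of `Δ(A)(1 ⊗ A)` in `A ⊗ A` makes the functions `(s, t) ↦ a(st)b(t)` vanish at
infinity, so that `(s, t) ↦ (st, t)` is proper. -/
theorem isProperMap_conv (h₁ : IsDenseSubspaceOf Δ.mulOneTensor) :
    IsProperMap fun p : characterSpace ℂ A × characterSpace ℂ A => (Δ.conv p.1 p.2, p.2) := by
  have hcont : Continuous fun p : characterSpace ℂ A × characterSpace ℂ A =>
    (Δ.conv p.1 p.2, p.2) := Δ.continuous_conv.prodMk continuous_snd
  refine isProperMap_iff_isCompact_preimage.2 ⟨hcont, fun K hK => ?_⟩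
  suffices h : ∃ C, IsCompact C ∧
      (fun p : characterSpace ℂ A × characterSpace ℂ A => (Δ.conv p.1 p.2, p.2)) ⁻¹' K ⊆ C by
    obtain ⟨C, hC, hKC⟩ := h
    exact hC.of_isClosed_subset (hK.isClosed.preimage hcont) hKC
  refine hK.induction_on (p := fun K => ∃ C, IsCompact C ∧
      (fun p : characterSpace ℂ A × characterSpace ℂ A => (Δ.conv p.1 p.2, p.2)) ⁻¹' K ⊆ C)
    ⟨∅, isCompact_empty, by simp⟩ (fun K L hKL ⟨C, hC, hLC⟩ => ⟨C, hC, fun p hp => hLC (hKL hp)⟩)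
    (fun K L ⟨C, hC, hKC⟩ ⟨D, hD, hLD⟩ => ⟨C ∪ D, hC.union hD, Set.union_subset_union hKC hLD⟩) ?_
  rintro ⟨x, y⟩ -
  -- where `a(x)b(y)` is bounded away from zero, so is the element `Δ(a)(1 ⊗ b)` of `A ⊗ A` on the
  -- preimage
  obtain ⟨a, ha⟩ := exists_apply_ne_zero x
  obtain ⟨b, hb⟩ := exists_apply_ne_zero y
  obtain ⟨z, hz⟩ := h₁.1 _ (Submodule.subset_span ⟨a, b, rfl⟩)
  have hpos : 0 < ‖x a * y b‖ := norm_pos_iff.2 (mul_ne_zero ha hb)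
  refine ⟨{q | ‖x a * y b‖ / 2 ≤ ‖q.1 a * q.2 b‖}, mem_nhdsWithin_of_mem_nhds ?_, _,
    (charHomeomorph A A).isCompact_preimage.2 (isCompact_le_norm_apply z (half_pos hpos)),
    fun p hp => ?_⟩
  · have hc : Continuous fun q : characterSpace ℂ A × characterSpace ℂ A => ‖q.1 a * q.2 b‖ :=
      (((continuous_apply a).comp continuous_fst).mul
        ((continuous_apply b).comp continuous_snd)).norm
    exact hc.continuousAt.eventually (eventually_ge_nhds (half_lt_self hpos))
  · change _ ≤ ‖tensorChar p.1 p.2 z‖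
    rw [← mult_coe (tensorChar p.1 p.2) z, hz, mult_mul_rightLeg]
    exact hp

end Convolution

variable [NonUnitalCommCStarAlgebra A] {Δ : Comultiplication A}

theorem surjective_conv (h₁ : IsDenseSubspaceOf Δ.mulOneTensor)
    (h₃ : ∀ a b : A, Δ a * rightLeg A A (b : 𝓜(ℂ, A)) = 0 → a = 0 ∨ b = 0) :
    Function.Surjective fun p : characterSpace ℂ A × characterSpace ℂ A =>
      (Δ.conv p.1 p.2, p.2) := by
  rw [← Set.range_eq_univ, Set.eq_univ_iff_forall]
  by_contra! ⟨⟨x, y⟩, hxy⟩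
  -- the range is closed, so its complement contains a rectangle, and functions supported in the
  -- sides of that rectangle violate `h₃`
  obtain ⟨U, V, hU, hV, hx, hy, hUV⟩ := isOpen_prod_iff.1
    (isProperMap_conv h₁).isClosedMap.isClosed_range.isOpen_compl x y hxy
  obtain ⟨a, hax, ha⟩ := exists_apply_ne_zero_of_isOpen hU hx
  obtain ⟨b, hby, hb⟩ := exists_apply_ne_zero_of_isOpen hV hy
  let _ := nonUnitalCommCStarAlgebra A A
  have h0 : Δ a * rightLeg A A (b : 𝓜(ℂ, A)) = 0 := eq_zero_of_forall_mult_eq_zero fun χ => by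
    obtain ⟨⟨s, t⟩, rfl⟩ := (charHomeomorph A A).surjective χ
    rw [charHomeomorph_apply, mult_mul_rightLeg]
    by_cases hs : Δ.conv s t ∈ U
    · by_cases ht : t ∈ V
      · exact absurd ⟨(s, t), rfl⟩ (hUV (Set.mk_mem_prod hs ht))
      · rw [hb t ht, mul_zero]
    · rw [ha _ hs, zero_mul]
  rcases h₃ a b h0 with rfl | rfl
  · exact hax (map_zero x)
  · exact hby (map_zero y)

end Comultiplication

/-! ### Locally compact semigroups with cancellation and division -/

/-- A nonempty semigroup with cancellation in which all equations `s * t = r` can be solved for `s`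
is a group. -/
abbrev groupOfCancelOfDivision {X : Type*} [Semigroup X] [Nonempty X]
    (hl : ∀ s t t' : X, s * t = s * t' → t = t') (hr : ∀ s s' t : X, s * t = s' * t → s = s')
    (hd : ∀ r t : X, ∃ s, s * t = r) : Group X :=
  let x : X := Classical.arbitrary X
  let e : X := (hd x x).choose
  have he : e * x = x := (hd x x).choose_spec
  have hee : e * e = e := hr _ _ x (by rw [mul_assoc, he, he])
  let _ : Inv X := ⟨fun t => (hd e t).choose⟩
  let _ : One X := ⟨e⟩
  Group.ofLeftAxioms mul_assoc (fun t => hl e _ _ (by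
      change e * (e * t) = e * t
      rw [← mul_assoc, hee]))
    fun t => (hd e t).choose_spec

/-- A group with a continuous multiplication is a topological group if `(s, t) ↦ (st, t)` is
closed, because the inverse is the first component of the preimage of `(1, t)`. -/
theorem isTopologicalGroup_of_isClosedMap {X : Type*} [Group X] [TopologicalSpace X]
    [ContinuousMul X] (h : IsClosedMap fun p : X × X => (p.1 * p.2, p.2)) :
    IsTopologicalGroup X where
  continuous_inv := by
    let T : X × X ≃ X × X :=
      { toFun := fun p => (p.1 * p.2, p.2)
        invFun := fun p => (p.1 * p.2⁻¹, p.2)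
        left_inv := fun p => by simp
        right_inv := fun p => by simp }
    have hT : Continuous T.symm :=
      (T.toHomeomorphOfContinuousClosed
        ((continuous_fst.mul continuous_snd).prodMk continuous_snd) h).symm.continuous
    exact (continuous_fst.comp (hT.comp (continuous_const (y := (1 : X)) |>.prodMk
      continuous_id))).congr fun t => one_mul t⁻¹

end

theorem theorem1p8 {A : Type u} [NonUnitalCommCStarAlgebra A] [Nontrivial A]
    (Δ : Comultiplication A)
    (h₁ : IsDenseSubspaceOf Δ.mulOneTensor)
    (h₂ : IsDenseSubspaceOf Δ.mulTensorOne)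
    (h₃ : ∀ a b : A, Δ a * CStarTensor.rightLeg A A (b : 𝓜(ℂ, A)) = 0 → a = 0 ∨ b = 0) :
    ∃ (G : Type u) (_ : Group G) (_ : TopologicalSpace G) (_ : IsTopologicalGroup G)
      (_ : T2Space G) (_ : LocallyCompactSpace G)
      -- the isomorphism of `A` with `C₀(G)`, and the induced one of `A ⊗ A` with `C₀(G × G)`
      (e : A ≃⋆ₐ[ℂ] C₀(G, ℂ)) (E : A ⊗⋆ A ≃⋆ₐ[ℂ] C₀(G × G, ℂ)),
      (∀ (a b : A) (s t : G), E (CStarTensor.tmul a b) (s, t) = e a s * e b t) ∧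
      -- `Δ(a)` is multiplication by the bounded continuous function `(s, t) ↦ a(st)` on `G × G`
      ∀ (a : A) (z : A ⊗⋆ A) (s t : G), E ((Δ a).fst z) (s, t) = e a (s * t) * E z (s, t) := by
  let X := WeakDual.characterSpace ℂ A
  let _ : Semigroup X := { mul := Δ.conv, mul_assoc := Δ.conv_assoc }
  have : ContinuousMul X := ⟨Δ.continuous_conv⟩
  let _ : Group X := groupOfCancelOfDivision (fun _ _ _ => Comultiplication.conv_left_cancel h₂)
    (fun _ _ _ => Comultiplication.conv_right_cancel h₁) fun r t => by
      obtain ⟨p, hp⟩ := Comultiplication.surjective_conv h₁ h₃ (r, t)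
      obtain ⟨h, rfl⟩ := Prod.ext_iff.1 hp
      exact ⟨p.1, h⟩
  refine ⟨X, inferInstance, inferInstance,
    isTopologicalGroup_of_isClosedMap (Comultiplication.isProperMap_conv h₁).isClosedMap,
    inferInstance, inferInstance, WeakDual.CharacterSpace.gelfandEquiv A,
    CStarTensor.gelfandTensorEquiv A A, fun a b s t => ?_, fun a z s t => ?_⟩
  · exact CStarTensor.tensorChar_tmul s t a b
  · exact WeakDual.CharacterSpace.apply_fst (CStarTensor.tensorChar s t) (Δ a) z
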